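/- A real distribution of order $0$ on $\mathbb R$ is the distributional derivative $r=R'$ of a function $R:\mathbb R\to\mathbb R$ of locally bounded variation; equivalently it is a real local measure $dR$, $r(\phi)=\int\phi\,dR$. Put $\Delta_r(x)=R^+(x)-R^-(x)$, where $R^\pm$ are the right- and left-hand limits of $R$. For a function $f$ of locally bounded variation the product $rf$ is the distribution $\phi\mapsto\int f\phi\,dR$. These notions are applied entrywise to matrices and vectors. A function $u$ of locally bounded variation is called balanced if $u=\frac12(u^++u^-)$ everywhere. Theorem. Let $J$ be a real, invertible, skew-symmetric $2\times2$-matrix, let $q$ and $w$ be $2\times2$-matrices whose entries are real distributions of order $0$ on $\mathbb R$, with $q$ symmetric and $w$ non-negative (i.e. the matrix $w(\phi)$ is symmetric and positive semidefinite for every test function $\phi\ge0$), and let $\omega>0$ be a period of both $q$ and $w$ (i.e. $r(\phi(\cdot+\omega))=r(\phi)$ for every entry $r$ and every test function $\phi$). For $x\in\mathbb R$ and $\lambda\in\mathbb C$ put $$B_\pm(x,\lambda)=J\pm\tfrac12\bigl(\Delta_q(x)-\lambda\Delta_w(x)\bigr),$$ and assume that $B_\pm(x,\lambda)$ are invertible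 for all $x,\lambda\in\mathbb R$. Let $\Lambda$ be the set of all $\lambda\in\mathbb C$ for which there is an $x\in\mathbb R$ with $\det B_+(x,\lambda)=\det B_-(x,\lambda)=0$ (the two determinants always coincide). If $\lambda\in\Lambda$ and $u:\mathbb R\to\mathbb C^2$ is a balanced function of locally bounded variation satisfying $Ju'+qu=\lambda wu$ in the sense of distributions, then $u(x)=0$ for every $x\in\mathbb R$. -/

import Mathlib

open Set Function MeasureTheory

/-- Real test functions on `ℝ`: infinitely differentiable, compactly supported. -/
abbrev RealTestFunction : Type := TestFunction (⊤ : TopologicalSpace.Opens ℝ) ℝ ⊤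

/-- Real distributions on `ℝ`. -/
abbrev RealDistribution : Type := Distribution (⊤ : TopologicalSpace.Opens ℝ) ℝ ⊤

/-- The translated test function `φ(· + ω)`. -/
noncomputable def RealTestFunction.translate (ω : ℝ) (φ : RealTestFunction) : RealTestFunction where
  toFun x := φ (x + ω)
  contDiff' := φ.contDiff.comp (contDiff_id.add contDiff_const)
  hasCompactSupport' := φ.hasCompactSupport.comp_homeomorph (Homeomorph.addRight ω)
  tsupport_subset' := fun _ _ => trivial

/-- `R` is a function of locally bounded variation whose distributional derivative is `r`. -/
def IsAntiderivative (R : ℝ → ℝ) (r : RealDistribution) : Prop :=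
  LocallyBoundedVariationOn R univ ∧ ∀ φ : RealTestFunction, r φ = -∫ x, R x * deriv φ x

/-- Real distributions of order `0` on `ℝ`, i.e. the distributional derivatives of real functions
of locally bounded variation. -/
def OrderZeroDistribution : Type :=
  {r : RealDistribution // ∃ R : ℝ → ℝ, IsAntiderivative R r}

namespace OrderZeroDistribution

/-- An antiderivative `R` of `r`. Two antiderivatives agree almost everywhere up to an additive
constant, so `jump` and `integral` below do not depend on the choice. -/
noncomputable def antideriv (r : OrderZeroDistribution) : ℝ → ℝ := r.2.choose

theorem isAntiderivative_antideriv (r : OrderZeroDistribution) :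
    IsAntiderivative r.antideriv r.1 := r.2.choose_spec

/-- `Δ_r(x) = R⁺(x) - R⁻(x)`. -/
noncomputable def jump (r : OrderZeroDistribution) (x : ℝ) : ℝ :=
  rightLim r.antideriv x - leftLim r.antideriv x

theorem monotone_variation (r : OrderZeroDistribution) :
    Monotone (fun x => variationOnFromTo r.antideriv univ 0 x) :=
  monotoneOn_univ.mp
    (variationOnFromTo.monotoneOn r.isAntiderivative_antideriv.1 (mem_univ 0))

theorem monotone_variation_sub (r : OrderZeroDistribution) :
    Monotone (fun x => variationOnFromTo r.antideriv univ 0 x - r.antideriv x) :=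
  monotoneOn_univ.mp
    (variationOnFromTo.sub_self_monotoneOn r.isAntiderivative_antideriv.1 (mem_univ 0))

/-- The Lebesgue-Stieltjes integral `∫ g dR`. Writing `V` for the variation function of `R`, this
is `∫ g dV - ∫ g d(V - R)`, where `V` and `V - R` are nondecreasing. It is used below only for
bounded Borel functions `g` with compact support, which are integrable for both measures. -/
noncomputable def integral (r : OrderZeroDistribution) (g : ℝ → ℂ) : ℂ :=
  (∫ x, g x ∂r.monotone_variation.stieltjesFunction.measure) -
    ∫ x, g x ∂r.monotone_variation_sub.stieltjesFunction.measure

/-- The product `r f`, as the functional `φ ↦ ∫ f φ dR`. -/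
noncomputable def mulFun (r : OrderZeroDistribution) (f : ℝ → ℂ) (φ : RealTestFunction) : ℂ :=
  r.integral (fun x => f x * (φ x : ℂ))

/-- `ω` is a period of `r`. -/
def HasPeriod (r : OrderZeroDistribution) (ω : ℝ) : Prop :=
  ∀ φ : RealTestFunction, r.1 (φ.translate ω) = r.1 φ

end OrderZeroDistribution

/-- `2 × 2`-matrices whose entries are real distributions of order `0`. -/
abbrev DistributionMatrix : Type := Matrix (Fin 2) (Fin 2) OrderZeroDistribution

namespace DistributionMatrix

/-- All entries of `r` have period `ω`. -/
def HasPeriod (r : DistributionMatrix) (ω : ℝ) : Prop :=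
  ∀ i j, (r i j).HasPeriod ω

/-- `r` is non-negative: testing `r` against a non-negative function gives a (symmetric) positive
semidefinite matrix. -/
def IsNonneg (r : DistributionMatrix) : Prop :=
  ∀ φ : RealTestFunction, (∀ x, 0 ≤ φ x) →
    (Matrix.of fun i j => (r i j).1 φ : Matrix (Fin 2) (Fin 2) ℝ).PosSemidef

/-- The matrix `Δ_r(x)`, regarded as a complex matrix. -/
noncomputable def jump (r : DistributionMatrix) (x : ℝ) : Matrix (Fin 2) (Fin 2) ℂ :=
  Matrix.of fun i j => ((r i j).jump x : ℂ)

end DistributionMatrix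

/-- `B₊(x, z) = J + (Δ_q(x) - z Δ_w(x)) / 2`. -/
noncomputable def BPlus (J : Matrix (Fin 2) (Fin 2) ℝ) (q w : DistributionMatrix) (x : ℝ) (z : ℂ) :
    Matrix (Fin 2) (Fin 2) ℂ :=
  J.map Complex.ofReal + (1 / 2 : ℂ) • (q.jump x - z • w.jump x)

/-- `B₋(x, z) = J - (Δ_q(x) - z Δ_w(x)) / 2`. -/
noncomputable def BMinus (J : Matrix (Fin 2) (Fin 2) ℝ) (q w : DistributionMatrix) (x : ℝ) (z : ℂ) :
    Matrix (Fin 2) (Fin 2) ℂ :=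
  J.map Complex.ofReal - (1 / 2 : ℂ) • (q.jump x - z • w.jump x)

/-- The set `Λ` of all `z` such that `det B₊(x, z) = det B₋(x, z) = 0` for some real `x`. -/
def singularSet (J : Matrix (Fin 2) (Fin 2) ℝ) (q w : DistributionMatrix) : Set ℂ :=
  {z | ∃ x : ℝ, (BPlus J q w x z).det = 0 ∧ (BMinus J q w x z).det = 0}

/-- `u` is balanced: `u = (u⁺ + u⁻) / 2` everywhere. -/
def IsBalanced (u : ℝ → Fin 2 → ℂ) : Prop :=
  ∀ x, u x = (1 / 2 : ℂ) • (rightLim u x + leftLim u x)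

/-- The distributional derivative `f'`, as the functional `φ ↦ -∫ f φ' dx`. -/
noncomputable def distribDeriv (f : ℝ → ℂ) (φ : RealTestFunction) : ℂ :=
  -∫ x, f x * ((deriv φ x : ℝ) : ℂ)

/-- `u` is a solution of `J u' + q u = z w u`: a balanced `ℂ²`-valued function of locally bounded
variation for which both sides agree as distributions. By linearity it is enough to test against
real test functions. -/
def IsSolution (J : Matrix (Fin 2) (Fin 2) ℝ) (q w : DistributionMatrix) (z : ℂ)
    (u : ℝ → Fin 2 → ℂ) : Prop :=
  LocallyBoundedVariationOn u univ ∧ IsBalanced u ∧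
    ∀ (φ : RealTestFunction) (i : Fin 2),
      ∑ j, (J i j : ℂ) * distribDeriv (fun x => u x j) φ +
          ∑ j, (q i j).mulFun (fun x => u x j) φ =
        z * ∑ j, (w i j).mulFun (fun x => u x j) φ

/-! The number `z` is not real, since `B₊` is invertible for real parameters. By periodicity `B₊`
and `B₋` are singular at `x₀ + nω` for every integer `n`, so it suffices to show that the right
limits `u⁺` vanish on `[a, b)` when `a < b` are singular points (`IsSolution.eq_zero_of_mem_Ico`).

At each point the equation says `B₊ u⁺ = B₋ u⁻`. In dimension two the adjugate is linear, so adj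
`B₊` + adj `B₋` = 2 adj `J`; at a singular point both adjugates kill the common value, which is
therefore zero (`jump_eq_zero_of_det_eq_zero`). Thus `u⁺(a)` lies in the kernel of `B₊` and `u⁻(b)`
in that of `B₋`: the interval decouples from the rest of the line.

The Lagrange identity on `(a, b)`, an integration by parts for balanced functions
(`energy_density`), expresses the boundary form at `b⁻` minus that at `a⁺` as `Im z` times the
integral of `u* w u`. The kernel relations (`energy_of_kernel`) turn the boundary terms into `Im z`
times jump forms of `w`. The outcome is that three non-negative numbers add up to zero, so each of
them vanishes.

Hence `Δ_w(a) u⁺(a) = 0`, which makes `u⁺(a)` a null vector of the invertible matrix `B₊(a, 0)`, and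
`w u = 0` inside. There the parameter may be replaced by `0`, so a zero left limit forces a zero
right limit, and the zero initial value spreads over `[a, b)` (`rightLim_eq_zero_of_jump`).

To work pointwise, all entries of `q` and `w` are written as bounded densities against one locally
finite measure `μ`. -/

open Filter Topology

/-! ### One-sided limits, local boundedness and measurability of functions of bounded variation. -/

section BoundedVariation

variable {E : Type*} [NormedAddCommGroup E] {f : ℝ → E}

theorem LocallyBoundedVariationOn.tendsto_leftLim [CompleteSpace E]
    (hf : LocallyBoundedVariationOn f univ) (x : ℝ) :
    Tendsto f (𝓝[<] x) (𝓝 (leftLim f x)) := by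
  apply tendsto_leftLim_of_tendsto
  obtain ⟨l, hl⟩ := (hf (x - 1) x (mem_univ _) (mem_univ _)).exists_tendsto_left x
  refine ⟨l, hl.mono_left ?_⟩
  refine nhdsWithin_le_iff.2 ?_
  filter_upwards [Ico_mem_nhdsLT (sub_one_lt x)] with y hy
  exact ⟨⟨mem_univ _, hy.1, hy.2.le⟩, hy.2⟩

theorem LocallyBoundedVariationOn.tendsto_rightLim [CompleteSpace E]
    (hf : LocallyBoundedVariationOn f univ) (x : ℝ) :
    Tendsto f (𝓝[>] x) (𝓝 (rightLim f x)) := by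
  apply tendsto_rightLim_of_tendsto
  obtain ⟨l, hl⟩ := (hf x (x + 1) (mem_univ _) (mem_univ _)).exists_tendsto_right x
  refine ⟨l, hl.mono_left ?_⟩
  refine nhdsWithin_le_iff.2 ?_
  filter_upwards [Ioc_mem_nhdsGT (lt_add_one x)] with y hy
  exact ⟨⟨mem_univ _, hy.1.le, hy.2⟩, hy.1⟩

theorem LocallyBoundedVariationOn.tendsto_rightLim_leftLim [CompleteSpace E]
    (hf : LocallyBoundedVariationOn f univ) (x : ℝ) :
    Tendsto (rightLim f) (𝓝[<] x) (𝓝 (leftLim f x)) := by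
  apply (closed_nhds_basis (leftLim f x)).tendsto_right_iff.2
  rintro s ⟨s_mem, s_closed⟩
  obtain ⟨l, hl, hls⟩ : ∃ l ∈ Iio x, Ioo l x ⊆ f ⁻¹' s :=
    mem_nhdsLT_iff_exists_Ioo_subset.1 (hf.tendsto_leftLim x s_mem)
  filter_upwards [Ioo_mem_nhdsLT hl] with c hc
  refine s_closed.mem_of_tendsto (hf.tendsto_rightLim c) ?_
  filter_upwards [Ioo_mem_nhdsGT hc.2] with y hy
  exact hls ⟨hc.1.trans hy.1, hy.2⟩

/-- `f` is bounded on every compact interval. -/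
def BoundedOnIcc (f : ℝ → E) : Prop := ∀ a b, ∃ C, ∀ x ∈ Icc a b, ‖f x‖ ≤ C

theorem LocallyBoundedVariationOn.boundedOnIcc (hf : LocallyBoundedVariationOn f univ) :
    BoundedOnIcc f := by
  intro a b
  refine ⟨‖f a‖ + (eVariationOn f (univ ∩ Icc a b)).toReal, fun x hx => ?_⟩
  have h := (hf a b (mem_univ _) (mem_univ _)).dist_le (x := x) (y := a) ⟨mem_univ _, hx⟩
    ⟨mem_univ _, le_rfl, hx.1.trans hx.2⟩
  rw [dist_eq_norm] at h
  linarith [norm_le_norm_add_norm_sub' (f x) (f a)]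

/-- Jordan decomposition: a difference of two monotone functions. -/
theorem LocallyBoundedVariationOn.measurable {f : ℝ → ℝ}
    (hf : LocallyBoundedVariationOn f univ) : Measurable f := by
  have h1 : Monotone (fun x => variationOnFromTo f univ 0 x) :=
    monotoneOn_univ.mp (variationOnFromTo.monotoneOn hf (mem_univ 0))
  have h2 : Monotone (fun x => variationOnFromTo f univ 0 x - f x) :=
    monotoneOn_univ.mp (variationOnFromTo.sub_self_monotoneOn hf (mem_univ 0))
  have h3 := h1.measurable.sub h2.measurable
  rwa [show ((fun x => variationOnFromTo f univ 0 x) -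
    fun x => variationOnFromTo f univ 0 x - f x) = f by ext x; simp] at h3

theorem LocallyBoundedVariationOn.measurable_complex {f : ℝ → ℂ}
    (hf : LocallyBoundedVariationOn f univ) : Measurable f := by
  have h1 : LocallyBoundedVariationOn (fun x => (f x).re) univ :=
    Complex.reCLM.lipschitz.comp_locallyBoundedVariationOn hf
  have h2 : LocallyBoundedVariationOn (fun x => (f x).im) univ :=
    Complex.imCLM.lipschitz.comp_locallyBoundedVariationOn hf
  exact measurable_of_re_im h1.measurable h2.measurable

theorem LocallyBoundedVariationOn.apply {ι : Type*} [Fintype ι] {f : ℝ → ι → ℂ}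
    (hf : LocallyBoundedVariationOn f univ) (i : ι) :
    LocallyBoundedVariationOn (fun x => f x i) univ :=
  (LipschitzWith.eval i).comp_locallyBoundedVariationOn hf

end BoundedVariation

/-! ### Test functions approximating indicators of half-open intervals. -/

section StepFunctions

/-- A smooth approximation of the indicator function of `(a, ∞)`. -/
noncomputable def smoothStep (a : ℝ) (n : ℕ) (x : ℝ) : ℝ :=
  Real.smoothTransition ((n + 1) * (x - a))

theorem smoothStep_of_le {a x : ℝ} (n : ℕ) (h : x ≤ a) : smoothStep a n x = 0 :=
  Real.smoothTransition.zero_of_nonpos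
    (mul_nonpos_of_nonneg_of_nonpos (by positivity) (sub_nonpos.2 h))

theorem smoothStep_of_ge {a x : ℝ} (n : ℕ) (h : a + 1 ≤ x) : smoothStep a n x = 1 := by
  apply Real.smoothTransition.one_of_one_le
  have : (0 : ℝ) ≤ n := n.cast_nonneg
  nlinarith

theorem contDiff_smoothStep (a : ℝ) (n : ℕ) {m : ℕ∞} : ContDiff ℝ m (smoothStep a n) :=
  Real.smoothTransition.contDiff.comp (contDiff_const.mul (contDiff_id.sub contDiff_const))

theorem tendsto_smoothStep {a x : ℝ} (h : a < x) :
    Tendsto (fun n => smoothStep a n x) atTop (𝓝 1) := by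
  have h1 : Tendsto (fun n : ℕ => ((n : ℝ) + 1) * (x - a)) atTop atTop :=
    (tendsto_atTop_add_const_right _ _ tendsto_natCast_atTop_atTop).atTop_mul_const
      (sub_pos.2 h)
  refine tendsto_const_nhds.congr' ?_
  filter_upwards [h1.eventually_ge_atTop 1] with n hn
  exact (Real.smoothTransition.one_of_one_le hn).symm

theorem smoothStep_antitone {a b : ℝ} (h : a ≤ b) (n : ℕ) (x : ℝ) :
    smoothStep b n x ≤ smoothStep a n x :=
  Real.smoothTransition.monotone (by gcongr)

/-- A test function approximating the indicator function of `(a, b]`. -/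
noncomputable def stepBump (a b : ℝ) (n : ℕ) : RealTestFunction where
  toFun x := smoothStep a n x - smoothStep b n x
  contDiff' := (contDiff_smoothStep a n).sub (contDiff_smoothStep b n)
  hasCompactSupport' := by
    refine HasCompactSupport.intro (K := Icc (min a b) (max a b + 1)) isCompact_Icc
      fun x hx => ?_
    rw [mem_Icc, not_and_or, not_le, not_le] at hx
    rcases hx with hx | hx
    · rw [lt_min_iff] at hx
      simp [smoothStep_of_le n hx.1.le, smoothStep_of_le n hx.2.le]
    · have h1 := le_max_left a b
      have h2 := le_max_right a b
      rw [smoothStep_of_ge n (by linarith), smoothStep_of_ge n (by linarith), sub_self]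
  tsupport_subset' := fun _ _ => trivial

theorem stepBump_apply (a b : ℝ) (n : ℕ) (x : ℝ) :
    stepBump a b n x = smoothStep a n x - smoothStep b n x := rfl

theorem stepBump_nonneg {a b : ℝ} (h : a ≤ b) (n : ℕ) (x : ℝ) : 0 ≤ stepBump a b n x :=
  sub_nonneg.2 (smoothStep_antitone h n x)

theorem stepBump_le_one (a b : ℝ) (n : ℕ) (x : ℝ) : stepBump a b n x ≤ 1 := by
  rw [stepBump_apply]
  have h1 : smoothStep a n x ≤ 1 := Real.smoothTransition.le_one _
  have h2 : 0 ≤ smoothStep b n x := Real.smoothTransition.nonneg _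
  linarith

theorem stepBump_eq_zero {a b : ℝ} (h : a ≤ b) (n : ℕ) {x : ℝ} (hx : x ∉ Icc a (b + 1)) :
    stepBump a b n x = 0 := by
  rw [mem_Icc, not_and_or, not_le, not_le] at hx
  rw [stepBump_apply]
  rcases hx with hx | hx
  · rw [smoothStep_of_le n hx.le, smoothStep_of_le n (hx.le.trans h), sub_self]
  · rw [smoothStep_of_ge n (by linarith), smoothStep_of_ge n hx.le, sub_self]

theorem translate_stepBump (a b ω : ℝ) (n : ℕ) :
    (stepBump (a + ω) (b + ω) n).translate ω = stepBump a b n := by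
  ext x
  change smoothStep (a + ω) n (x + ω) - smoothStep (b + ω) n (x + ω) = _
  simp [stepBump_apply, smoothStep]

theorem deriv_smoothStep (a : ℝ) (n : ℕ) (x : ℝ) :
    deriv (smoothStep a n) x = (n + 1) * deriv Real.smoothTransition ((n + 1) * (x - a)) := by
  have h1 : HasDerivAt Real.smoothTransition (deriv Real.smoothTransition ((n + 1) * (x - a)))
      ((n + 1) * (x - a)) :=
    ((Real.smoothTransition.contDiff (n := 1)).differentiable (by simp) _).hasDerivAt
  have h2 : HasDerivAt (fun x : ℝ => ((n : ℝ) + 1) * (x - a)) (n + 1) x := by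
    simpa using ((hasDerivAt_id x).sub_const a).const_mul ((n : ℝ) + 1)
  rw [mul_comm]
  exact (h1.comp x h2).deriv

theorem continuous_deriv_smoothTransition : Continuous (deriv Real.smoothTransition) :=
  (Real.smoothTransition.contDiff (n := 1)).continuous_deriv (by simp)

theorem deriv_smoothTransition_eq_zero {y : ℝ} (hy : y ∉ Icc (0 : ℝ) 1) :
    deriv Real.smoothTransition y = 0 := by
  rw [mem_Icc, not_and_or, not_le, not_le] at hy
  rcases hy with hy | hy
  · have : Real.smoothTransition =ᶠ[𝓝 y] fun _ => 0 := by
      filter_upwards [Iio_mem_nhds hy] with x hx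
      exact Real.smoothTransition.zero_of_nonpos (le_of_lt hx)
    rw [this.deriv_eq, deriv_const]
  · have : Real.smoothTransition =ᶠ[𝓝 y] fun _ => 1 := by
      filter_upwards [Ioi_mem_nhds hy] with x hx
      exact Real.smoothTransition.one_of_one_le (le_of_lt hx)
    rw [this.deriv_eq, deriv_const]

theorem integral_deriv_smoothTransition : ∫ y, deriv Real.smoothTransition y = 1 := by
  rw [← setIntegral_eq_integral_of_forall_compl_eq_zero
    (fun y hy => deriv_smoothTransition_eq_zero hy), integral_Icc_eq_integral_Ioc,
    ← intervalIntegral.integral_of_le zero_le_one, intervalIntegral.integral_deriv_eq_sub]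
  · simp
  · intro x _
    exact (Real.smoothTransition.contDiff (n := 1)).differentiable (by simp) x
  · exact continuous_deriv_smoothTransition.intervalIntegrable _ _

theorem integrable_of_boundedOnIcc {E : Type*} [NormedAddCommGroup E] {μ : Measure ℝ} [IsLocallyFiniteMeasure μ] {g : ℝ → E}
    (hg : StronglyMeasurable g) (hb : BoundedOnIcc g) (a b : ℝ) : IntegrableOn g (Icc a b) μ := by
  obtain ⟨C, hC⟩ := hb a b
  exact Measure.integrableOn_of_bounded (isCompact_Icc.measure_lt_top).ne
    hg.aestronglyMeasurable ((ae_restrict_iff' measurableSet_Icc).2 (Eventually.of_forall hC))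

variable {E : Type*} [NormedAddCommGroup E] [NormedSpace ℝ E]

theorem integrable_deriv_smoothStep_smul {f : ℝ → E} (hm : StronglyMeasurable f)
    (hb : BoundedOnIcc f) (a : ℝ) (n : ℕ) : Integrable (fun x => deriv (smoothStep a n) x • f x) := by
  have hc : Continuous (deriv (smoothStep a n)) :=
    (contDiff_smoothStep a n (m := 1)).continuous_deriv (by simp)
  have h : IntegrableOn (fun x => deriv (smoothStep a n) x • f x) (Icc a (a + 1)) := by
    refine integrable_of_boundedOnIcc (hc.stronglyMeasurable.smul hm) (fun c d => ?_) _ _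
    obtain ⟨C, hC⟩ := hb c d
    obtain ⟨D, hD⟩ := isCompact_Icc.exists_bound_of_continuousOn (s := Icc c d) hc.continuousOn
    refine ⟨D * C, fun x hx => ?_⟩
    rw [Pi.smul_apply', norm_smul]
    exact mul_le_mul (hD x hx) (hC x hx) (norm_nonneg _) ((norm_nonneg _).trans (hD x hx))
  rw [integrableOn_iff_integrable_of_support_subset] at h
  · exact h
  · intro x hx
    by_contra hx'
    apply hx
    beta_reduce
    rw [deriv_smoothStep, deriv_smoothTransition_eq_zero, mul_zero, zero_smul]
    intro hy
    apply hx'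
    have hn : (0 : ℝ) ≤ n := n.cast_nonneg
    constructor
    · by_contra! hlt
      nlinarith [hy.1]
    · by_contra! hlt
      nlinarith [hy.2]

/-- The derivative of the step is a mollifier of mass one living on `[a, a + 1/(n+1)]`, so in the
limit it sees only values of `f` to the right of `a`. -/
theorem tendsto_integral_deriv_smoothStep_smul [CompleteSpace E] {f : ℝ → E}
    (hm : StronglyMeasurable f)
    (hb : BoundedOnIcc f) {a : ℝ} {l : E} (hl : Tendsto f (𝓝[>] a) (𝓝 l)) :
    Tendsto (fun n => ∫ x, deriv (smoothStep a n) x • f x) atTop (𝓝 l) := by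
  -- Substitution `x = a + y/(n+1)`, which makes the mollifier independent of `n`.
  have hsub : ∀ n : ℕ, ∫ x, deriv (smoothStep a n) x • f x =
      ∫ y, deriv Real.smoothTransition y • f (a + ((n : ℝ) + 1)⁻¹ * y) := by
    intro n
    have hn : (0 : ℝ) < (n : ℝ) + 1 := by positivity
    rw [← integral_add_left_eq_self _ a]
    have := Measure.integral_comp_mul_left
      (fun x => deriv (smoothStep a n) (a + x) • f (a + x)) ((n : ℝ) + 1)⁻¹
    rw [inv_inv, abs_of_pos hn] at this
    rw [← inv_smul_smul₀ hn.ne' (∫ x, deriv (smoothStep a n) (a + x) • f (a + x)), ← this,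
      ← integral_smul]
    congr 1 with y
    rw [deriv_smoothStep, smul_smul, add_sub_cancel_left, mul_inv_cancel_left₀ hn.ne',
      inv_mul_cancel_left₀ hn.ne']
  simp_rw [hsub]
  have hlim : l = ∫ y, deriv Real.smoothTransition y • l := by
    rw [integral_smul_const, integral_deriv_smoothTransition, one_smul]
  rw [hlim]
  obtain ⟨C, hC⟩ := hb a (a + 1)
  obtain ⟨D, hD⟩ := isCompact_Icc.exists_bound_of_continuousOn (s := Icc (0 : ℝ) 1)
    continuous_deriv_smoothTransition.continuousOn
  refine tendsto_integral_of_dominated_convergence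
    ((Icc (0 : ℝ) 1).indicator fun _ => D * C) ?_ ?_ ?_ ?_
  · intro n
    exact (continuous_deriv_smoothTransition.stronglyMeasurable.smul
      (hm.comp_measurable (by fun_prop))).aestronglyMeasurable
  · rw [integrable_indicator_iff measurableSet_Icc]
    exact integrableOn_const (by simp)
  · intro n
    refine Eventually.of_forall fun y => ?_
    by_cases hy : y ∈ Icc (0 : ℝ) 1
    · rw [indicator_of_mem hy, norm_smul]
      refine mul_le_mul (hD y hy) (hC _ ⟨?_, ?_⟩) (norm_nonneg _)
        ((norm_nonneg _).trans (hD y hy))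
      · have := hy.1
        have : 0 ≤ ((n : ℝ) + 1)⁻¹ * y := by positivity
        linarith
      · have h1 : ((n : ℝ) + 1)⁻¹ ≤ 1 := inv_le_one_of_one_le₀ (by simp)
        have : ((n : ℝ) + 1)⁻¹ * y ≤ 1 := mul_le_one₀ h1 hy.1 hy.2
        linarith
    · rw [indicator_of_notMem hy, deriv_smoothTransition_eq_zero hy, zero_smul, norm_zero]
  · filter_upwards [Measure.ae_ne volume (0 : ℝ)] with y hy
    rcases lt_or_gt_of_ne hy with hy | hy
    · rw [deriv_smoothTransition_eq_zero (fun h => hy.not_ge h.1)]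
      simp
    · refine (hl.comp ?_).const_smul _
      refine tendsto_nhdsWithin_iff.2 ⟨?_, Eventually.of_forall fun n => ?_⟩
      · have := (tendsto_one_div_add_atTop_nhds_zero_nat (𝕜 := ℝ)).mul_const y
        simpa using this.const_add a
      · have : 0 < ((n : ℝ) + 1)⁻¹ * y := by positivity
        exact lt_add_of_pos_right a this

/-- Recovers increments of `f` from its distributional derivative. Both ends give right limits,
which matches mass on `(a, b]`. -/
theorem tendsto_neg_integral_deriv_stepBump_smul [CompleteSpace E] {f : ℝ → E}
    (hm : StronglyMeasurable f) (hf : LocallyBoundedVariationOn f univ) (a b : ℝ) :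
    Tendsto (fun n => -∫ x, deriv (stepBump a b n) x • f x) atTop
      (𝓝 (rightLim f b - rightLim f a)) := by
  have hb := hf.boundedOnIcc
  have h := (tendsto_integral_deriv_smoothStep_smul hm hb (hf.tendsto_rightLim b)).sub
    (tendsto_integral_deriv_smoothStep_smul hm hb (hf.tendsto_rightLim a))
  refine h.congr fun n => ?_
  rw [← integral_sub (integrable_deriv_smoothStep_smul hm hb b n)
    (integrable_deriv_smoothStep_smul hm hb a n), ← integral_neg]
  congr 1 with x
  have hd : ∀ c, DifferentiableAt ℝ (smoothStep c n) x := fun c =>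
    (contDiff_smoothStep c n (m := 1)).differentiable (by simp) x
  have : deriv (stepBump a b n) x = deriv (smoothStep a n) x - deriv (smoothStep b n) x :=
    deriv_sub (hd a) (hd b)
  rw [this, sub_smul, neg_sub]

theorem tendsto_stepBump {a b : ℝ} (h : a ≤ b) (x : ℝ) :
    Tendsto (fun n => stepBump a b n x) atTop (𝓝 ((Ioc a b).indicator 1 x)) := by
  simp_rw [stepBump_apply]
  rcases le_or_gt x a with hxa | hxa
  · rw [indicator_of_notMem (fun hx => hx.1.not_ge hxa)]
    simp [smoothStep_of_le _ hxa, smoothStep_of_le _ (hxa.trans h)]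
  rcases le_or_gt x b with hxb | hxb
  · rw [indicator_of_mem (show x ∈ Ioc a b from ⟨hxa, hxb⟩)]
    simpa [smoothStep_of_le _ hxb] using tendsto_smoothStep hxa
  · rw [indicator_of_notMem (fun hx => hx.2.not_gt hxb)]
    simpa using (tendsto_smoothStep hxa).sub (tendsto_smoothStep hxb)

theorem tendsto_integral_stepBump_smul {μ : Measure ℝ} {g : ℝ → E}
    (hm : StronglyMeasurable g) {a b : ℝ} (hi : IntegrableOn g (Icc a (b + 1)) μ) (h : a ≤ b) :
    Tendsto (fun n => ∫ x, stepBump a b n x • g x ∂μ) atTop (𝓝 (∫ x in Ioc a b, g x ∂μ)) := by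
  rw [← integral_indicator measurableSet_Ioc]
  refine tendsto_integral_of_dominated_convergence ((Icc a (b + 1)).indicator fun x => ‖g x‖)
    ?_ ?_ ?_ ?_
  · intro n
    exact ((stepBump a b n).continuous.stronglyMeasurable.smul hm).aestronglyMeasurable
  · rw [integrable_indicator_iff measurableSet_Icc]
    exact hi.norm
  · intro n
    refine Eventually.of_forall fun x => ?_
    by_cases hx : x ∈ Icc a (b + 1)
    · rw [indicator_of_mem hx, norm_smul, Real.norm_of_nonneg (stepBump_nonneg h n x)]
      exact mul_le_of_le_one_left (norm_nonneg _) (stepBump_le_one a b n x)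
    · rw [indicator_of_notMem hx, stepBump_eq_zero h n hx, zero_smul, norm_zero]
  · refine Eventually.of_forall fun x => ?_
    have := (tendsto_stepBump h x).smul_const (g x)
    by_cases hx : x ∈ Ioc a b
    · simpa [hx] using this
    · simpa [hx] using this

end StepFunctions

/-! ### Scalar distributions of order zero as bounded densities against a dominating measure. -/

namespace OrderZeroDistribution

variable (r : OrderZeroDistribution)

/-- The measure `dV`, where `V` is the variation function of the antiderivative of `r`. -/
noncomputable def variationMeasure : Measure ℝ := r.monotone_variation.stieltjesFunction.measure

/-- The measure `d(V - R)`, where `V` is the variation function of the antiderivative `R` of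
`r`. -/
noncomputable def variationSubMeasure : Measure ℝ :=
  r.monotone_variation_sub.stieltjesFunction.measure

instance : IsLocallyFiniteMeasure r.variationMeasure := by
  unfold variationMeasure; infer_instance

instance : IsLocallyFiniteMeasure r.variationSubMeasure := by
  unfold variationSubMeasure; infer_instance

theorem rightLim_variation_sub (x : ℝ) :
    rightLim (fun x => variationOnFromTo r.antideriv univ 0 x - r.antideriv x) x =
      rightLim (fun x => variationOnFromTo r.antideriv univ 0 x) x - rightLim r.antideriv x :=
  rightLim_eq_of_tendsto ((r.monotone_variation.tendsto_rightLim x).sub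
    (r.isAntiderivative_antideriv.1.tendsto_rightLim x))

theorem leftLim_variation_sub (x : ℝ) :
    leftLim (fun x => variationOnFromTo r.antideriv univ 0 x - r.antideriv x) x =
      leftLim (fun x => variationOnFromTo r.antideriv univ 0 x) x - leftLim r.antideriv x :=
  leftLim_eq_of_tendsto ((r.monotone_variation.tendsto_leftLim x).sub
    (r.isAntiderivative_antideriv.1.tendsto_leftLim x))

theorem real_variationMeasure_Ioc {a b : ℝ} (h : a ≤ b) :
    r.variationMeasure.real (Ioc a b) - r.variationSubMeasure.real (Ioc a b) =
      rightLim r.antideriv b - rightLim r.antideriv a := by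
  have h1 := r.monotone_variation.rightLim h
  have h2 := r.monotone_variation_sub.rightLim h
  simp only [measureReal_def, variationMeasure, variationSubMeasure,
    StieltjesFunction.measure_Ioc, Monotone.stieltjesFunction_eq]
  rw [ENNReal.toReal_ofReal (sub_nonneg.2 h1), ENNReal.toReal_ofReal (sub_nonneg.2 h2)]
  simp only [rightLim_variation_sub]
  ring

theorem real_variationMeasure_singleton (x : ℝ) :
    r.variationMeasure.real {x} - r.variationSubMeasure.real {x} = r.jump x := by
  -- The Stieltjes function is the right-continuous modification of the variation function; the
  -- modification does not change left limits.
  have e1 : leftLim r.monotone_variation.stieltjesFunction x =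
      leftLim (fun x => variationOnFromTo r.antideriv univ 0 x) x :=
    leftLim_rightLim (r.monotone_variation.tendsto_leftLim x)
  have e2 : leftLim r.monotone_variation_sub.stieltjesFunction x =
      leftLim (fun x => variationOnFromTo r.antideriv univ 0 x - r.antideriv x) x :=
    leftLim_rightLim (r.monotone_variation_sub.tendsto_leftLim x)
  have h1 := r.monotone_variation.leftLim_le_rightLim (le_refl x)
  have h2 := r.monotone_variation_sub.leftLim_le_rightLim (le_refl x)
  simp only [measureReal_def, variationMeasure, variationSubMeasure,
    StieltjesFunction.measure_singleton, Monotone.stieltjesFunction_eq, e1, e2]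
  rw [ENNReal.toReal_ofReal (sub_nonneg.2 h1), ENNReal.toReal_ofReal (sub_nonneg.2 h2)]
  simp only [rightLim_variation_sub, leftLim_variation_sub, jump]
  ring

/-- `μ` dominates the two measures whose difference is `r`. -/
def DominatedBy (μ : Measure ℝ) : Prop :=
  r.variationMeasure ≤ μ ∧ r.variationSubMeasure ≤ μ

/-- The density of `r` with respect to a measure that dominates `r`. -/
noncomputable def density (μ : Measure ℝ) (x : ℝ) : ℝ :=
  (r.variationMeasure.rnDeriv μ x).toReal - (r.variationSubMeasure.rnDeriv μ x).toReal

theorem measurable_density (μ : Measure ℝ) : Measurable (r.density μ) :=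
  (Measure.measurable_rnDeriv _ _).ennreal_toReal.sub
    (Measure.measurable_rnDeriv _ _).ennreal_toReal

variable {r} {μ : Measure ℝ} [IsLocallyFiniteMeasure μ]

theorem ae_toReal_rnDeriv_mem_Icc {ν : Measure ℝ} (h : ν ≤ μ) :
    ∀ᵐ x ∂μ, (ν.rnDeriv μ x).toReal ∈ Icc (0 : ℝ) 1 := by
  filter_upwards [Measure.rnDeriv_le_one_of_le h] with x hx
  exact ⟨ENNReal.toReal_nonneg, ENNReal.toReal_le_of_le_ofReal zero_le_one (by simpa using hx)⟩

theorem DominatedBy.ae_abs_density_le (h : r.DominatedBy μ) :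
    ∀ᵐ x ∂μ, |r.density μ x| ≤ 1 := by
  filter_upwards [ae_toReal_rnDeriv_mem_Icc h.1, ae_toReal_rnDeriv_mem_Icc h.2] with x h1 h2
  rw [density, abs_le]
  constructor <;> linarith [h1.1, h1.2, h2.1, h2.2]

theorem DominatedBy.locallyIntegrable_density (h : r.DominatedBy μ) :
    LocallyIntegrable (r.density μ) μ := by
  refine (locallyIntegrable_const (1 : ℝ)).mono
    (r.measurable_density μ).aestronglyMeasurable ?_
  filter_upwards [h.ae_abs_density_le] with x hx
  simpa using hx

theorem DominatedBy.setIntegral_density (h : r.DominatedBy μ) {s : Set ℝ} (hs : μ s ≠ ⊤) :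
    ∫ x in s, r.density μ x ∂μ = r.variationMeasure.real s - r.variationSubMeasure.real s := by
  have key : ∀ ν : Measure ℝ, ν ≤ μ →
      IntegrableOn (fun x => (ν.rnDeriv μ x).toReal) s μ := by
    intro ν hν
    refine Measure.integrableOn_of_bounded (M := 1) hs
      (Measure.measurable_rnDeriv _ _).ennreal_toReal.aestronglyMeasurable
      (ae_restrict_of_ae ?_)
    filter_upwards [ae_toReal_rnDeriv_mem_Icc hν] with x hx
    rw [Real.norm_of_nonneg hx.1]
    exact hx.2
  simp only [density]
  rw [integral_sub (key _ h.1) (key _ h.2),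
    Measure.setIntegral_toReal_rnDeriv (Measure.absolutelyContinuous_of_le h.1),
    Measure.setIntegral_toReal_rnDeriv (Measure.absolutelyContinuous_of_le h.2)]

theorem DominatedBy.setIntegral_density_Ioc (h : r.DominatedBy μ) {a b : ℝ} (hab : a ≤ b) :
    ∫ x in Ioc a b, r.density μ x ∂μ = rightLim r.antideriv b - rightLim r.antideriv a := by
  rw [h.setIntegral_density measure_Ioc_lt_top.ne, r.real_variationMeasure_Ioc hab]

theorem DominatedBy.measureReal_mul_density (h : r.DominatedBy μ) (x : ℝ) :
    μ.real {x} * r.density μ x = r.jump x := by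
  rw [← r.real_variationMeasure_singleton, ← h.setIntegral_density
    isCompact_singleton.measure_lt_top.ne,
    integral_singleton, smul_eq_mul]

theorem DominatedBy.integral_eq (h : r.DominatedBy μ) {g : ℝ → ℂ} (hg : Integrable g μ) :
    r.integral g = ∫ x, r.density μ x • g x ∂μ := by
  have key : ∀ ν : Measure ℝ, ν ≤ μ →
      Integrable (fun x => (ν.rnDeriv μ x).toReal • g x) μ := by
    intro ν hν
    refine hg.bdd_smul 1
      (Measure.measurable_rnDeriv _ _).ennreal_toReal.aestronglyMeasurable ?_
    filter_upwards [ae_toReal_rnDeriv_mem_Icc hν] with x hx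
    rw [Real.norm_of_nonneg hx.1]
    exact hx.2
  simp only [density, sub_smul]
  rw [integral_sub (key _ h.1) (key _ h.2),
    integral_rnDeriv_smul (Measure.absolutelyContinuous_of_le h.1),
    integral_rnDeriv_smul (Measure.absolutelyContinuous_of_le h.2)]
  rfl

variable (r)

theorem tendsto_apply_stepBump (a b : ℝ) :
    Tendsto (fun n => r.1 (stepBump a b n)) atTop
      (𝓝 (rightLim r.antideriv b - rightLim r.antideriv a)) := by
  have h := r.isAntiderivative_antideriv
  refine (tendsto_neg_integral_deriv_stepBump_smul h.1.measurable.stronglyMeasurable h.1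
    a b).congr fun n => ?_
  rw [h.2]
  simp only [smul_eq_mul, mul_comm]

variable {r}

theorem HasPeriod.rightLim_sub {ω : ℝ} (h : r.HasPeriod ω) (a b : ℝ) :
    rightLim r.antideriv (b + ω) - rightLim r.antideriv (a + ω) =
      rightLim r.antideriv b - rightLim r.antideriv a := by
  refine tendsto_nhds_unique (r.tendsto_apply_stepBump (a + ω) (b + ω)) ?_
  refine (r.tendsto_apply_stepBump a b).congr fun n => ?_
  rw [← translate_stepBump a b ω, h]

theorem tendsto_rightLim_antideriv (r : OrderZeroDistribution) (x : ℝ) :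
    Tendsto (fun a => rightLim r.antideriv x - rightLim r.antideriv a) (𝓝[<] x)
      (𝓝 (r.jump x)) :=
  (r.isAntiderivative_antideriv.1.tendsto_rightLim_leftLim x).const_sub _

/-- The jump at `x` is the limit of the increments over `(a, x]` as `a` increases to `x`, and these
increments are invariant under translation by the period. -/
theorem HasPeriod.periodic_jump {ω : ℝ} (h : r.HasPeriod ω) : Periodic r.jump ω := by
  intro x
  refine tendsto_nhds_unique (f := fun a => rightLim r.antideriv x - rightLim r.antideriv a)
    (l := 𝓝[<] x) ?_ (r.tendsto_rightLim_antideriv x)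
  have h1 : Tendsto (fun a => a + ω) (𝓝[<] x) (𝓝[<] (x + ω)) := by
    refine tendsto_nhdsWithin_iff.2 ⟨?_, ?_⟩
    · exact ((continuous_id.add continuous_const).tendsto x).mono_left nhdsWithin_le_nhds
    · filter_upwards [self_mem_nhdsWithin] with a ha
      simpa using ha
  exact ((r.tendsto_rightLim_antideriv (x + ω)).comp h1).congr fun a => h.rightLim_sub a x

end OrderZeroDistribution

theorem OrderZeroDistribution.DominatedBy.mono {r : OrderZeroDistribution} {μ ν : Measure ℝ}
    (h : r.DominatedBy μ) (hμν : μ ≤ ν) : r.DominatedBy ν :=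
  ⟨h.1.trans hμν, h.2.trans hμν⟩

/-! ### Non-negative matrix distributions have positive semidefinite densities. -/

namespace DistributionMatrix

variable (r : DistributionMatrix)

/-- The sum of the measures from which the entries of `r` are formed. -/
noncomputable def totalMeasure : Measure ℝ :=
  ∑ i, ∑ j, ((r i j).variationMeasure + (r i j).variationSubMeasure)

instance : IsLocallyFiniteMeasure r.totalMeasure := by
  have : IsFiniteMeasureOnCompacts r.totalMeasure := by
    refine ⟨fun K hK => ?_⟩
    simp [totalMeasure, Fin.sum_univ_two, hK.measure_lt_top]
  infer_instance

theorem dominatedBy_totalMeasure (i j : Fin 2) : (r i j).DominatedBy r.totalMeasure := by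
  have key : (r i j).variationMeasure + (r i j).variationSubMeasure ≤ r.totalMeasure := by
    unfold totalMeasure
    exact (Finset.single_le_sum (f := fun j => (r i j).variationMeasure +
        (r i j).variationSubMeasure) (fun _ _ => Measure.zero_le _) (Finset.mem_univ j)).trans
      (Finset.single_le_sum (f := fun i => ∑ j, ((r i j).variationMeasure +
        (r i j).variationSubMeasure)) (fun _ _ => Measure.zero_le _) (Finset.mem_univ i))
  exact ⟨(Measure.le_add_right le_rfl).trans key, (Measure.le_add_left le_rfl).trans key⟩

/-- The matrix of the densities of the entries of `r`. -/
noncomputable def density (μ : Measure ℝ) (x : ℝ) : Matrix (Fin 2) (Fin 2) ℝ :=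
  Matrix.of fun i j => (r i j).density μ x

variable {r} {μ : Measure ℝ} [IsLocallyFiniteMeasure μ]

theorem isClosed_posSemidef : IsClosed {A : Matrix (Fin 2) (Fin 2) ℝ | A.PosSemidef} := by
  simp only [Matrix.posSemidef_iff_dotProduct_mulVec, ofPred_and, ofPred_forall]
  refine IsClosed.inter ?_ (isClosed_iInter fun x => ?_)
  · exact isClosed_eq (by fun_prop) continuous_id
  · exact isClosed_le continuous_const (by fun_prop)

theorem posSemidef_of_tendsto {α : Type*} {l : Filter α} [l.NeBot]
    {f : α → Matrix (Fin 2) (Fin 2) ℝ} {A : Matrix (Fin 2) (Fin 2) ℝ}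
    (h : ∀ i j, Tendsto (fun n => f n i j) l (𝓝 (A i j))) (hf : ∀ᶠ n in l, (f n).PosSemidef) :
    A.PosSemidef := by
  have h' : Tendsto f l (𝓝 A) := tendsto_pi_nhds.2 fun i => tendsto_pi_nhds.2 fun j => h i j
  exact isClosed_posSemidef.mem_of_tendsto h' hf

theorem IsNonneg.posSemidef_setIntegral_Ioc (h : r.IsNonneg)
    (hμ : ∀ i j, (r i j).DominatedBy μ) {a b : ℝ} (hab : a ≤ b) :
    (Matrix.of fun i j => ∫ x in Ioc a b, (r i j).density μ x ∂μ).PosSemidef := by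
  refine posSemidef_of_tendsto (l := atTop)
    (f := fun n => Matrix.of fun i j => (r i j).1 (stepBump a b n)) (fun i j => ?_)
    (Eventually.of_forall fun n => h _ (stepBump_nonneg hab n))
  simp only [Matrix.of_apply, (hμ i j).setIntegral_density_Ioc hab]
  exact (r i j).tendsto_apply_stepBump a b

theorem IsNonneg.posSemidef_setIntegral_Icc (h : r.IsNonneg)
    (hμ : ∀ i j, (r i j).DominatedBy μ) {a b : ℝ} (hab : a ≤ b) :
    (Matrix.of fun i j => ∫ x in Icc a b, (r i j).density μ x ∂μ).PosSemidef := by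
  refine posSemidef_of_tendsto (l := atTop)
    (f := fun n : ℕ => Matrix.of fun i j => ∫ x in Ioc (a - 1 / ((n : ℝ) + 1)) b,
      (r i j).density μ x ∂μ) (fun i j => ?_)
    (Eventually.of_forall fun n => h.posSemidef_setIntegral_Ioc hμ
      (by have : 0 < 1 / ((n : ℝ) + 1) := by positivity
          linarith))
  simp only [Matrix.of_apply]
  have hI : Icc a b = ⋂ n : ℕ, Ioc (a - 1 / ((n : ℝ) + 1)) b := by
    ext x
    simp only [mem_Icc, mem_iInter, mem_Ioc]
    refine ⟨fun hx n => ⟨?_, hx.2⟩, fun hx => ⟨?_, (hx 0).2⟩⟩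
    · have : 0 < 1 / ((n : ℝ) + 1) := by positivity
      linarith [hx.1]
    · have h1 := (tendsto_one_div_add_atTop_nhds_zero_nat (𝕜 := ℝ)).const_sub a
      rw [sub_zero] at h1
      exact le_of_tendsto h1 (Eventually.of_forall fun n => (hx n).1.le)
  rw [hI]
  refine tendsto_setIntegral_of_antitone (fun n => measurableSet_Ioc) ?_ ⟨0, ?_⟩
  · intro m n hmn
    refine Ioc_subset_Ioc_left ?_
    have : (1 : ℝ) / ((n : ℝ) + 1) ≤ 1 / ((m : ℝ) + 1) := by gcongr
    linarith
  · exact ((hμ i j).locallyIntegrable_density.integrableOn_isCompact isCompact_Icc).mono_set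
      Ioc_subset_Icc_self

/-- Besicovitch differentiation: almost everywhere the density is a limit of its averages over small
closed balls, that is, compact intervals, and positive semidefinite matrices form a closed cone. -/
theorem IsNonneg.ae_posSemidef_density (h : r.IsNonneg) (hμ : ∀ i j, (r i j).DominatedBy μ) :
    ∀ᵐ x ∂μ, (r.density μ x).PosSemidef := by
  have key : ∀ᵐ x ∂μ, ∀ i j, Tendsto (fun ε => ⨍ y in Metric.closedBall x ε,
      (r i j).density μ y ∂μ) (𝓝[>] 0) (𝓝 ((r i j).density μ x)) := by
    refine ae_all_iff.2 fun i => ae_all_iff.2 fun j => ?_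
    filter_upwards [(Besicovitch.vitaliFamily μ).ae_tendsto_average
      (hμ i j).locallyIntegrable_density] with x hx
    exact hx.comp (Besicovitch.tendsto_filterAt μ x)
  filter_upwards [key] with x hx
  refine posSemidef_of_tendsto (l := 𝓝[>] (0 : ℝ))
    (f := fun ε => Matrix.of fun i j => ⨍ y in Metric.closedBall x ε, (r i j).density μ y ∂μ)
    hx ?_
  filter_upwards [self_mem_nhdsWithin] with ε hε
  have h2 := (h.posSemidef_setIntegral_Icc hμ (a := x - ε) (b := x + ε)
    (by linarith [mem_Ioi.1 hε])).smul
    (inv_nonneg.2 (measureReal_nonneg (μ := μ) (s := Metric.closedBall x ε)))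
  convert! h2 using 1
  ext i j
  simp [setAverage_eq, Real.closedBall_eq_Icc]

end DistributionMatrix

/-! ### Fubini on a triangle and integration by parts for balanced functions. -/

section Product

variable {ν : Measure ℝ} {f g : ℝ → ℂ}

theorem measurableSet_snd_lt_fst : MeasurableSet {p : ℝ × ℝ | p.2 < p.1} :=
  measurableSet_lt measurable_snd measurable_fst

theorem integral_indicator_snd_lt_fst (f g : ℝ → ℂ) (x : ℝ) :
    ∫ y, ({p : ℝ × ℝ | p.2 < p.1}.indicator fun p => f p.1 * g p.2) (x, y) ∂ν =
      f x * ∫ y in Iio x, g y ∂ν := by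
  rw [← integral_indicator measurableSet_Iio, ← integral_const_mul]
  congr 1 with y
  by_cases h : y < x <;> simp [h]

theorem integral_indicator_compl_snd_lt_fst (f g : ℝ → ℂ) (y : ℝ) :
    ∫ x, ({p : ℝ × ℝ | p.2 < p.1}ᶜ.indicator fun p => f p.1 * g p.2) (x, y) ∂ν =
      (∫ x in Iic y, f x ∂ν) * g y := by
  rw [← integral_indicator measurableSet_Iic, ← integral_mul_const]
  congr 1 with x
  by_cases h : y < x
  · simp [h]
  · simp [h, not_lt.1 h]

variable [SFinite ν]

theorem integrable_mul_setIntegral_Iio (hf : Integrable f ν) (hg : Integrable g ν) :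
    Integrable (fun x => f x * ∫ y in Iio x, g y ∂ν) ν := by
  have h := ((hf.mul_prod hg).indicator measurableSet_snd_lt_fst).integral_prod_left
  simpa only [integral_indicator_snd_lt_fst] using h

theorem integrable_setIntegral_Iic_mul (hf : Integrable f ν) (hg : Integrable g ν) :
    Integrable (fun y => (∫ x in Iic y, f x ∂ν) * g y) ν := by
  have h := ((hf.mul_prod hg).indicator measurableSet_snd_lt_fst.compl).integral_prod_right
  simpa only [integral_indicator_compl_snd_lt_fst] using h

/-- Fubini after splitting the plane into `y < x` and `x ≤ y`. The diagonal, which carries mass at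
common atoms, goes to the second part; hence the asymmetry of `Iio` and `Iic`. -/
theorem integral_mul_integral_eq_add (hf : Integrable f ν) (hg : Integrable g ν) :
    (∫ x, f x ∂ν) * ∫ y, g y ∂ν =
      ∫ x, f x * ∫ y in Iio x, g y ∂ν ∂ν + ∫ y, (∫ x in Iic y, f x ∂ν) * g y ∂ν := by
  have hfg := hf.mul_prod hg
  have h1 := hfg.indicator measurableSet_snd_lt_fst
  have h2 := hfg.indicator measurableSet_snd_lt_fst.compl
  rw [← integral_prod_mul,
    ← integral_add_compl measurableSet_snd_lt_fst hfg,
    ← integral_indicator measurableSet_snd_lt_fst,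
    ← integral_indicator measurableSet_snd_lt_fst.compl, integral_prod _ h1,
    integral_prod_symm _ h2]
  simp only [integral_indicator_snd_lt_fst, integral_indicator_compl_snd_lt_fst]

end Product

/-- `F` is a balanced function of locally bounded variation with `dF = f dμ`. -/
structure IsBalancedPrimitive (μ : Measure ℝ) (f F : ℝ → ℂ) : Prop where
  locallyBoundedVariationOn : LocallyBoundedVariationOn F univ
  eq_half_add : ∀ x, F x = (1 / 2 : ℂ) * (rightLim F x + leftLim F x)
  integrableOn : ∀ a b, IntegrableOn f (Icc a b) μ
  rightLim_sub_rightLim : ∀ a b, a ≤ b → rightLim F b - rightLim F a = ∫ x in Ioc a b, f x ∂μ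

namespace IsBalancedPrimitive

variable {μ : Measure ℝ} {f g F G : ℝ → ℂ}

theorem integrableOn_Ioo (hF : IsBalancedPrimitive μ f F) (a b : ℝ) :
    IntegrableOn f (Ioo a b) μ :=
  (hF.integrableOn a b).mono_set Ioo_subset_Icc_self

theorem leftLim_sub_rightLim (hF : IsBalancedPrimitive μ f F) {a b : ℝ} (hab : a < b) :
    leftLim F b - rightLim F a = ∫ x in Ioo a b, f x ∂μ := by
  obtain ⟨c, hc, hcm, hcl⟩ := exists_seq_strictMono_tendsto' hab
  have hU : Ioo a b = ⋃ n, Ioc a (c n) := by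
    ext x
    simp only [mem_Ioo, mem_iUnion, mem_Ioc]
    constructor
    · rintro ⟨h1, h2⟩
      obtain ⟨n, hn⟩ := (hcl.eventually (eventually_gt_nhds h2)).exists
      exact ⟨n, h1, hn.le⟩
    · rintro ⟨n, h1, h2⟩
      exact ⟨h1, h2.trans_lt (hcm n).2⟩
  have h1 : Tendsto (fun n => ∫ x in Ioc a (c n), f x ∂μ) atTop
      (𝓝 (∫ x in Ioo a b, f x ∂μ)) := by
    rw [hU]
    refine tendsto_setIntegral_of_monotone (fun n => measurableSet_Ioc)
      (fun m n hmn => Ioc_subset_Ioc_right (hc.monotone hmn)) ?_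
    rw [← hU]
    exact hF.integrableOn_Ioo a b
  refine tendsto_nhds_unique ?_ h1
  have hcl' : Tendsto c atTop (𝓝[<] b) :=
    tendsto_nhdsWithin_iff.2 ⟨hcl, Eventually.of_forall fun n => (hcm n).2⟩
  have h2 := (hF.locallyBoundedVariationOn.tendsto_rightLim_leftLim b).comp hcl'
  exact (h2.sub_const (rightLim F a)).congr fun n =>
    hF.rightLim_sub_rightLim a (c n) (hcm n).1.le

theorem rightLim_sub_leftLim (hF : IsBalancedPrimitive μ f F) (x : ℝ) :
    rightLim F x - leftLim F x = μ.real {x} * f x := by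
  have hlt := sub_one_lt x
  have h1 := hF.rightLim_sub_rightLim _ _ hlt.le
  have h2 := hF.leftLim_sub_rightLim hlt
  rw [← Ioo_union_right hlt, setIntegral_union (by simp) (measurableSet_singleton x)
    (hF.integrableOn_Ioo _ _)
    ((hF.integrableOn x x).mono_set (by simp)), ← h2, integral_singleton] at h1
  rw [Complex.real_smul] at h1
  linear_combination h1

theorem conj (hF : IsBalancedPrimitive μ f F) :
    IsBalancedPrimitive μ (fun x => starRingEnd ℂ (f x)) (fun x => starRingEnd ℂ (F x)) := by
  have hr : ∀ x, rightLim (fun x => starRingEnd ℂ (F x)) x = starRingEnd ℂ (rightLim F x) :=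
    fun x => rightLim_eq_of_tendsto
      ((Complex.continuous_conj.tendsto _).comp (hF.locallyBoundedVariationOn.tendsto_rightLim x))
  have hl : ∀ x, leftLim (fun x => starRingEnd ℂ (F x)) x = starRingEnd ℂ (leftLim F x) :=
    fun x => leftLim_eq_of_tendsto
      ((Complex.continuous_conj.tendsto _).comp (hF.locallyBoundedVariationOn.tendsto_leftLim x))
  refine ⟨?_, fun x => ?_, fun a b => ?_, fun a b hab => ?_⟩
  · exact Complex.conjLIE.lipschitz.comp_locallyBoundedVariationOn hF.locallyBoundedVariationOn
  · rw [hr, hl]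
    conv_lhs => rw [hF.eq_half_add x]
    rw [map_mul, map_add, show starRingEnd ℂ (1 / 2 : ℂ) = 1 / 2 by
      simpa using Complex.conj_ofReal (1 / 2)]
  · exact (Complex.conjLIE : ℂ ≃ₗᵢ[ℝ] ℂ).integrable_comp_iff.2 (hF.integrableOn a b)
  · rw [hr, hr, integral_conj, ← hF.rightLim_sub_rightLim a b hab, map_sub]

/-- Integration by parts for balanced functions of locally bounded variation. -/
theorem integrableOn_and_mul_sub_mul (hF : IsBalancedPrimitive μ f F)
    (hG : IsBalancedPrimitive μ g G) [SFinite μ] {a b : ℝ} (hab : a < b) :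
    IntegrableOn (fun x => f x * G x + F x * g x) (Ioo a b) μ ∧
      leftLim F b * leftLim G b - rightLim F a * rightLim G a =
        ∫ x in Ioo a b, (f x * G x + F x * g x) ∂μ := by
  have hf : Integrable f (μ.restrict (Ioo a b)) := hF.integrableOn_Ioo a b
  have hg : Integrable g (μ.restrict (Ioo a b)) := hG.integrableOn_Ioo a b
  have key : ∀ {h H : ℝ → ℂ}, IsBalancedPrimitive μ h H → ∀ x ∈ Ioo a b,
      (∫ y in Iio x, h y ∂(μ.restrict (Ioo a b))) = leftLim H x - rightLim H a ∧
      (∫ y in Iic x, h y ∂(μ.restrict (Ioo a b))) = rightLim H x - rightLim H a := by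
    intro h H hH x hx
    rw [Measure.restrict_restrict measurableSet_Iio, Measure.restrict_restrict measurableSet_Iic,
      hH.leftLim_sub_rightLim hx.1, hH.rightLim_sub_rightLim _ _ hx.1.le]
    have e1 : Iio x ∩ Ioo a b = Ioo a x := by
      ext y
      simp only [mem_inter_iff, mem_Iio, mem_Ioo]
      exact ⟨fun h => ⟨h.2.1, h.1⟩, fun h => ⟨h.2, h.1, h.2.trans hx.2⟩⟩
    have e2 : Iic x ∩ Ioo a b = Ioc a x := by
      ext y
      simp only [mem_inter_iff, mem_Iic, mem_Ioo, mem_Ioc]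
      exact ⟨fun h => ⟨h.2.1, h.1⟩, fun h => ⟨h.2, h.1, h.2.trans_lt hx.2⟩⟩
    rw [e1, e2]
    exact ⟨rfl, rfl⟩
  have i1 := integrable_mul_setIntegral_Iio hf hg
  have i2 := integrable_setIntegral_Iic_mul hf hg
  have i3 := integrable_mul_setIntegral_Iio hg hf
  have i4 := integrable_setIntegral_Iic_mul hg hf
  -- Averaging the Fubini identities for `(f, g)` and `(g, f)` pairs each density with the mean of
  -- the left and right limits of the other function, which is its balanced value.
  have hsum := ((i1.add i2).add (i3.add i4)).const_mul (1 / 2)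
  -- The inner integrals only measure increments from `a⁺`; these terms restore the initial values.
  have i5 := (hf.mul_const (rightLim G a)).add (hg.mul_const (rightLim F a))
  have hcongr : ∀ x ∈ Ioo a b, (1 / 2 : ℂ) *
      ((f x * ∫ y in Iio x, g y ∂(μ.restrict (Ioo a b))) +
        (∫ y in Iic x, f y ∂(μ.restrict (Ioo a b))) * g x +
      ((g x * ∫ y in Iio x, f y ∂(μ.restrict (Ioo a b))) +
        (∫ y in Iic x, g y ∂(μ.restrict (Ioo a b))) * f x)) +
      (f x * rightLim G a + g x * rightLim F a) = f x * G x + F x * g x := by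
    intro x hx
    rw [(key hF x hx).1, (key hF x hx).2, (key hG x hx).1, (key hG x hx).2,
      hF.eq_half_add x, hG.eq_half_add x]
    ring
  refine ⟨IntegrableOn.congr_fun (hsum.add i5) hcongr measurableSet_Ioo, ?_⟩
  have e1 := integral_mul_integral_eq_add hf hg
  have e2 := integral_mul_integral_eq_add hg hf
  rw [← setIntegral_congr_fun measurableSet_Ioo hcongr]
  have e3 := integral_add hsum i5
  have e4 := integral_add (i1.add i2) (i3.add i4)
  have e5 := integral_add i1 i2
  have e6 := integral_add i3 i4
  have e7 := integral_add (hf.mul_const (rightLim G a)) (hg.mul_const (rightLim F a))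
  simp only [Pi.add_apply] at e3 e4 e5 e6 e7
  rw [e3, integral_const_mul, e4, e5, e6, e7, ← e1, ← e2, integral_mul_const, integral_mul_const,
    ← hF.leftLim_sub_rightLim hab, ← hG.leftLim_sub_rightLim hab]
  ring

end IsBalancedPrimitive

/-! ### Propagation of zero initial values. -/

section Uniqueness

variable {ι : Type*} [Fintype ι] {μ : Measure ℝ} [IsLocallyFiniteMeasure μ] {h u : ℝ → ι → ℂ}

/-- The intervals `(a, a + δ]` shrink to the empty set, so even an atom at `a` does no harm. -/
theorem exists_measureReal_Ioc_le (μ : Measure ℝ) [IsLocallyFiniteMeasure μ] (a : ℝ) {ε : ℝ}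
    (hε : 0 < ε) : ∃ δ > 0, μ.real (Ioc a (a + δ)) ≤ ε := by
  have h1 : Tendsto (fun n : ℕ => μ (Ioc a (a + 1 / ((n : ℝ) + 1)))) atTop
      (𝓝 (μ (⋂ n : ℕ, Ioc a (a + 1 / ((n : ℝ) + 1))))) := by
    refine tendsto_measure_iInter_atTop (fun n => measurableSet_Ioc.nullMeasurableSet) ?_
      ⟨0, measure_Ioc_lt_top.ne⟩
    intro m n hmn
    refine Ioc_subset_Ioc_right ?_
    have : (1 : ℝ) / ((n : ℝ) + 1) ≤ 1 / ((m : ℝ) + 1) := by gcongr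
    linarith
  have h2 : ⋂ n : ℕ, Ioc a (a + 1 / ((n : ℝ) + 1)) = ∅ := by
    refine eq_empty_iff_forall_notMem.2 fun x hx => ?_
    simp only [mem_iInter, mem_Ioc] at hx
    have h3 := (tendsto_one_div_add_atTop_nhds_zero_nat (𝕜 := ℝ)).const_add a
    rw [add_zero] at h3
    exact (ge_of_tendsto h3 (Eventually.of_forall fun n => (hx n).2)).not_gt (hx 0).1
  rw [h2, measure_empty] at h1
  obtain ⟨n, hn⟩ := (h1.eventually_le_const (ENNReal.ofReal_pos.2 hε)).exists
  exact ⟨1 / ((n : ℝ) + 1), by positivity, ENNReal.toReal_le_of_le_ofReal hε.le hn⟩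

/-- A Gronwall argument by contraction: where `μ` has little mass, any bound for `u` implies half
that bound for both one-sided limits, hence for the balanced value, and iterating gives zero. -/
theorem exists_rightLim_eq_zero_on_Ioc
    (hu : ∀ i, IsBalancedPrimitive μ (fun x => h x i) (fun x => u x i)) {K : ℝ} (hK : 0 < K)
    (hh : ∀ᵐ x ∂μ, ∀ i, ‖h x i‖ ≤ K * ‖u x‖) {a : ℝ} (ha : ∀ i, rightLim (fun x => u x i) a = 0) :
    ∃ δ > 0, ∀ x ∈ Ioc a (a + δ), ∀ i, rightLim (fun x => u x i) x = 0 := by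
  -- With this mass, `‖h‖ ≤ K B` integrates to at most `B / 2`.
  obtain ⟨δ, hδ, hμ⟩ := exists_measureReal_Ioc_le μ a (ε := 1 / (2 * K)) (by positivity)
  refine ⟨δ, hδ, ?_⟩
  have hfin : ∀ s ⊆ Ioc a (a + δ), μ s < ⊤ := fun s hs =>
    (measure_mono hs).trans_lt measure_Ioc_lt_top
  have hint : ∀ B : ℝ, (∀ x ∈ Ioc a (a + δ), ‖u x‖ ≤ B) → 0 ≤ B → ∀ s ⊆ Ioc a (a + δ),
      MeasurableSet s → ∀ i, ‖∫ x in s, h x i ∂μ‖ ≤ B / 2 := by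
    intro B hB hB0 s hs hsm i
    have h1 : ‖∫ x in s, h x i ∂μ‖ ≤ K * B * μ.real s := by
      refine norm_setIntegral_le_of_norm_le_const_ae (hfin s hs) ?_
      filter_upwards [ae_restrict_of_ae hh, ae_restrict_mem hsm] with x hx hxs
      exact (hx i).trans (by gcongr; exact hB x (hs hxs))
    have h2 : μ.real s ≤ 1 / (2 * K) :=
      (measureReal_mono hs measure_Ioc_lt_top.ne).trans hμ
    calc _ ≤ K * B * (1 / (2 * K)) := h1.trans (by gcongr)
      _ = B / 2 := by field_simp
  have hright : ∀ B : ℝ, (∀ x ∈ Ioc a (a + δ), ‖u x‖ ≤ B) → 0 ≤ B → ∀ x ∈ Ioc a (a + δ), ∀ i,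
      ‖rightLim (fun x => u x i) x‖ ≤ B / 2 := by
    intro B hB hB0 x hx i
    have h1 := (hu i).rightLim_sub_rightLim a x hx.1.le
    rw [ha i, sub_zero] at h1
    rw [h1]
    exact hint B hB hB0 _ (Ioc_subset_Ioc_right hx.2) measurableSet_Ioc i
  have hleft : ∀ B : ℝ, (∀ x ∈ Ioc a (a + δ), ‖u x‖ ≤ B) → 0 ≤ B → ∀ x ∈ Ioc a (a + δ), ∀ i,
      ‖leftLim (fun x => u x i) x‖ ≤ B / 2 := by
    intro B hB hB0 x hx i
    have h1 := (hu i).leftLim_sub_rightLim hx.1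
    rw [ha i, sub_zero] at h1
    rw [h1]
    exact hint B hB hB0 _ (Ioo_subset_Ioc_self.trans (Ioc_subset_Ioc_right hx.2))
      measurableSet_Ioo i
  have hstep : ∀ B : ℝ, (∀ x ∈ Ioc a (a + δ), ‖u x‖ ≤ B) → 0 ≤ B →
      ∀ x ∈ Ioc a (a + δ), ‖u x‖ ≤ B / 2 := by
    intro B hB hB0 x hx
    refine (pi_norm_le_iff_of_nonneg (by positivity)).2 fun i => ?_
    have h1 := (hu i).eq_half_add x
    beta_reduce at h1
    rw [h1, norm_mul]
    have h2 := norm_add_le (rightLim (fun x => u x i) x) (leftLim (fun x => u x i) x)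
    have h3 := hright B hB hB0 x hx i
    have h4 := hleft B hB hB0 x hx i
    norm_num
    linarith
  choose C hC using fun i => (hu i).locallyBoundedVariationOn.boundedOnIcc a (a + δ)
  have hbound : ∀ x ∈ Ioc a (a + δ), ‖u x‖ ≤ ∑ i, |C i| := by
    intro x hx
    refine (pi_norm_le_iff_of_nonneg (by positivity)).2 fun i => ?_
    exact ((hC i x (Ioc_subset_Icc_self hx)).trans (le_abs_self _)).trans
      (Finset.single_le_sum (f := fun i => |C i|) (fun _ _ => abs_nonneg _) (Finset.mem_univ i))
  have hiter : ∀ n : ℕ, ∀ x ∈ Ioc a (a + δ), ‖u x‖ ≤ (∑ i, |C i|) * (1 / 2) ^ n := by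
    intro n
    induction n with
    | zero => simpa using hbound
    | succ n ih =>
      have := hstep _ ih (by positivity)
      intro x hx
      rw [pow_succ]
      linarith [this x hx]
  have hzero : ∀ x ∈ Ioc a (a + δ), ‖u x‖ ≤ 0 := by
    intro x hx
    have h1 := (tendsto_pow_atTop_nhds_zero_of_lt_one (r := (1 / 2 : ℝ)) (by norm_num)
      (by norm_num)).const_mul (∑ i, |C i|)
    rw [mul_zero] at h1
    exact ge_of_tendsto h1 (Eventually.of_forall fun n => hiter n x hx)
  intro x hx i
  simpa using hright 0 hzero le_rfl x hx i

/-- The local result cannot cross an atom of large mass, where a balanced solution need not be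
determined by its left limit; `hjump` supplies exactly this crossing. The proof examines the infimum
of the points with nonzero right limit. -/
theorem rightLim_eq_zero_of_jump
    (hu : ∀ i, IsBalancedPrimitive μ (fun x => h x i) (fun x => u x i)) {K : ℝ} (hK : 0 < K)
    (hh : ∀ᵐ x ∂μ, ∀ i, ‖h x i‖ ≤ K * ‖u x‖) {a b : ℝ}
    (ha : ∀ i, rightLim (fun x => u x i) a = 0)
    (hjump : ∀ x ∈ Ioo a b, (∀ i, leftLim (fun x => u x i) x = 0) →
      ∀ i, rightLim (fun x => u x i) x = 0) {x : ℝ} (hx : x ∈ Ico a b) (i : ι) :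
    rightLim (fun x => u x i) x = 0 := by
  by_contra hne
  set A : Set ℝ := {t | a ≤ t ∧ ∃ j, rightLim (fun x => u x j) t ≠ 0} with hA
  have hxA : x ∈ A := ⟨hx.1, i, hne⟩
  have hbdd : BddBelow A := ⟨a, fun t ht => ht.1⟩
  have hT1 : a ≤ sInf A := le_csInf ⟨x, hxA⟩ fun t ht => ht.1
  have hT2 : sInf A ≤ x := csInf_le hbdd hxA
  have hlt : ∀ t, a ≤ t → t < sInf A → ∀ j, rightLim (fun x => u x j) t = 0 := by
    intro t hat ht j
    by_contra hj
    exact (csInf_le hbdd (⟨hat, j, hj⟩ : t ∈ A)).not_gt ht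
  have hT : ∀ j, rightLim (fun x => u x j) (sInf A) = 0 := by
    rcases hT1.eq_or_lt with h1 | h1
    · rwa [← h1]
    · refine hjump _ ⟨h1, hT2.trans_lt hx.2⟩ fun j => ?_
      refine tendsto_nhds_unique
        ((hu j).locallyBoundedVariationOn.tendsto_rightLim_leftLim (sInf A)) ?_
      refine tendsto_const_nhds.congr' ?_
      filter_upwards [Ioo_mem_nhdsLT h1] with t ht
      exact (hlt t ht.1.le ht.2 j).symm
  obtain ⟨δ, hδ, hzero⟩ := exists_rightLim_eq_zero_on_Ioc hu hK hh hT
  obtain ⟨t, htA, ht⟩ := exists_lt_of_csInf_lt ⟨x, hxA⟩ (lt_add_of_pos_right (sInf A) hδ)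
  obtain ⟨j, hj⟩ := htA.2
  rcases (csInf_le hbdd htA).eq_or_lt with h1 | h1
  · exact hj (h1 ▸ hT j)
  · exact hj (hzero t ⟨h1, ht.le⟩ j)

end Uniqueness

/-! ### Real positive semidefinite matrices on complex vectors. -/

section QuadraticForm

/-- The real part of the hermitian form of a real matrix at a complex vector. -/
noncomputable def complexQuadForm (A : Matrix (Fin 2) (Fin 2) ℝ) (v : Fin 2 → ℂ) : ℝ :=
  ∑ i, ∑ j, A i j * (starRingEnd ℂ (v i) * v j).re

theorem complexQuadForm_eq (A : Matrix (Fin 2) (Fin 2) ℝ) (v : Fin 2 → ℂ) :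
    complexQuadForm A v = star (fun i => (v i).re) ⬝ᵥ A.mulVec (fun i => (v i).re) +
      star (fun i => (v i).im) ⬝ᵥ A.mulVec (fun i => (v i).im) := by
  simp only [complexQuadForm, dotProduct, Matrix.mulVec, Fin.sum_univ_two, Pi.star_apply,
    Complex.mul_re, Complex.conj_re, Complex.conj_im, star_trivial]
  ring

theorem complexQuadForm_nonneg {A : Matrix (Fin 2) (Fin 2) ℝ} (hA : A.PosSemidef)
    (v : Fin 2 → ℂ) : 0 ≤ complexQuadForm A v := by
  rw [complexQuadForm_eq]
  exact add_nonneg (hA.dotProduct_mulVec_nonneg _) (hA.dotProduct_mulVec_nonneg _)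

theorem sum_mul_eq_zero_of_complexQuadForm {A : Matrix (Fin 2) (Fin 2) ℝ} (hA : A.PosSemidef)
    {v : Fin 2 → ℂ} (h : complexQuadForm A v = 0) (i : Fin 2) : ∑ j, (A i j : ℂ) * v j = 0 := by
  rw [complexQuadForm_eq] at h
  have h1 := hA.dotProduct_mulVec_nonneg (fun i => (v i).re)
  have h2 := hA.dotProduct_mulVec_nonneg (fun i => (v i).im)
  have e1 := (hA.dotProduct_mulVec_zero_iff _).1
    (show star (fun i => (v i).re) ⬝ᵥ A.mulVec (fun i => (v i).re) = 0 by linarith)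
  have e2 := (hA.dotProduct_mulVec_zero_iff _).1
    (show star (fun i => (v i).im) ⬝ᵥ A.mulVec (fun i => (v i).im) = 0 by linarith)
  have f1 := congrFun e1 i
  have f2 := congrFun e2 i
  simp only [Matrix.mulVec, dotProduct, Pi.zero_apply, Fin.sum_univ_two] at f1 f2
  rw [Fin.sum_univ_two]
  apply Complex.ext
  · simpa using f1
  · simpa using f2

end QuadraticForm

/-! ### Algebra of the jump relation and of the energy identity. -/

section JumpAlgebra

/-- If `B₊ p = B₋ m` with singular `B± = J ± S`, then both sides vanish. -/
theorem jump_eq_zero_of_det_eq_zero {c s₀ s₁ s₂ p₀ p₁ m₀ m₁ : ℂ} (hc : c ≠ 0)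
    (hdet : s₀ * s₂ - (s₁ + c) * (s₁ - c) = 0)
    (h0 : c * (p₁ - m₁) + s₀ * (p₀ + m₀) + s₁ * (p₁ + m₁) = 0)
    (h1 : -c * (p₀ - m₀) + s₁ * (p₀ + m₀) + s₂ * (p₁ + m₁) = 0) :
    (s₀ * p₀ + (s₁ + c) * p₁ = 0 ∧ (s₁ - c) * p₀ + s₂ * p₁ = 0) ∧
      (s₀ * m₀ + (s₁ - c) * m₁ = 0 ∧ (s₁ + c) * m₀ + s₂ * m₁ = 0) := by
  -- Apply adj `B₋` to `B₊ p - B₋ m = 0`. Since adj `B₋` = 2 adj `J` - adj `B₊` and both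
  -- determinants vanish, only 2 adj `J` `B₊ p` survives, whence the factor `2c`.
  have hv1 : (s₁ - c) * p₀ + s₂ * p₁ = 0 := by
    apply mul_left_cancel₀ (mul_ne_zero two_ne_zero hc)
    linear_combination -(p₀ + m₀) * hdet + s₂ * h0 - (s₁ - c) * h1
  have hv0 : s₀ * p₀ + (s₁ + c) * p₁ = 0 := by
    apply mul_left_cancel₀ (mul_ne_zero two_ne_zero hc)
    linear_combination (p₁ + m₁) * hdet + (s₁ + c) * h0 - s₀ * h1
  exact ⟨⟨hv0, hv1⟩, by linear_combination h0 - hv0, by linear_combination h1 - hv1⟩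

/-- Multiply the kernel equation by `v*` and take imaginary parts: the real symmetric `E` drops out,
and the skew part doubles, turning `1/2` into `1/4`. -/
theorem energy_of_kernel {D E : Matrix (Fin 2) (Fin 2) ℝ} (hD : D 1 0 = D 0 1)
    (hE : E 1 0 = E 0 1) (c : ℝ) (z : ℂ) {v : Fin 2 → ℂ}
    (h0 : c * v 1 + 1 / 2 * ∑ j, ((E 0 j : ℂ) - z * D 0 j) * v j = 0)
    (h1 : -c * v 0 + 1 / 2 * ∑ j, ((E 1 j : ℂ) - z * D 1 j) * v j = 0) :
    c * (starRingEnd ℂ (v 0) * v 1).im = 1 / 4 * (z.im * complexQuadForm D v) := by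
  have e0 := congrArg (fun x => (starRingEnd ℂ (v 0) * x).im) h0
  have e1 := congrArg (fun x => (starRingEnd ℂ (v 1) * x).im) h1
  simp [Fin.sum_univ_two, complexQuadForm, hD, hE] at e0 e1 ⊢
  linear_combination (1 / 2) * e0 + (1 / 2) * e1

/-- Pointwise Lagrange identity: with `h` the density of `u'`, the left side is the density of the
boundary form, and the real symmetric `Q` has no imaginary contribution. -/
theorem energy_density {Q W : Matrix (Fin 2) (Fin 2) ℝ} (hQ : Q 1 0 = Q 0 1)
    (hW : W 1 0 = W 0 1) {c : ℝ} (z : ℂ) {v h : Fin 2 → ℂ}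
    (h0 : c * h 1 = ∑ j, (z * W 0 j - Q 0 j) * v j)
    (h1 : -c * h 0 = ∑ j, (z * W 1 j - Q 1 j) * v j) :
    c * (starRingEnd ℂ (h 0) * v 1 + starRingEnd ℂ (v 0) * h 1).im =
      z.im * complexQuadForm W v := by
  have e0 := congrArg (fun x => (starRingEnd ℂ (v 0) * x).im) h0
  have e1 := congrArg (fun x => (starRingEnd ℂ (v 1) * x).im) h1
  simp [Fin.sum_univ_two, complexQuadForm, hQ, hW] at e0 e1 ⊢
  linear_combination e0 + e1

end JumpAlgebra

/-! ### From the distributional equation to an integral equation against `μ`. -/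

section IntegralEquation

variable {μ : Measure ℝ} [IsLocallyFiniteMeasure μ]

theorem OrderZeroDistribution.DominatedBy.integrableOn_density_mul {r : OrderZeroDistribution}
    (h : r.DominatedBy μ) {f : ℝ → ℂ} (hf : LocallyBoundedVariationOn f univ) (a b : ℝ) :
    IntegrableOn (fun x => (r.density μ x : ℂ) * f x) (Icc a b) μ := by
  have h1 : IntegrableOn f (Icc a b) μ :=
    integrable_of_boundedOnIcc hf.measurable_complex.stronglyMeasurable hf.boundedOnIcc a b
  refine Integrable.bdd_mul (c := 1) h1
    (Complex.measurable_ofReal.comp (r.measurable_density μ)).aestronglyMeasurable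
    (ae_restrict_of_ae ?_)
  filter_upwards [h.ae_abs_density_le] with x hx
  simpa using hx

theorem OrderZeroDistribution.DominatedBy.tendsto_mulFun_stepBump {r : OrderZeroDistribution}
    (h : r.DominatedBy μ) {f : ℝ → ℂ} (hf : LocallyBoundedVariationOn f univ) {a b : ℝ}
    (hab : a ≤ b) :
    Tendsto (fun n => r.mulFun f (stepBump a b n)) atTop
      (𝓝 (∫ x in Ioc a b, (r.density μ x : ℂ) * f x ∂μ)) := by
  have hm : StronglyMeasurable (fun x => (r.density μ x : ℂ) * f x) :=
    ((Complex.measurable_ofReal.comp (r.measurable_density μ)).mul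
      hf.measurable_complex).stronglyMeasurable
  refine (tendsto_integral_stepBump_smul hm (h.integrableOn_density_mul hf a (b + 1))
    hab).congr fun n => ?_
  have hint : Integrable (fun x => f x * (stepBump a b n x : ℂ)) μ := by
    have h1 : IntegrableOn f (Icc a (b + 1)) μ :=
      integrable_of_boundedOnIcc hf.measurable_complex.stronglyMeasurable hf.boundedOnIcc _ _
    have h2 : IntegrableOn (fun x => f x * (stepBump a b n x : ℂ)) (Icc a (b + 1)) μ := by
      refine Integrable.mul_bdd (c := 1) h1
        (Complex.continuous_ofReal.comp (stepBump a b n).continuous).aestronglyMeasurable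
        (Eventually.of_forall fun x => ?_)
      simpa [abs_of_nonneg (stepBump_nonneg hab n x)] using stepBump_le_one a b n x
    refine (integrableOn_iff_integrable_of_support_subset fun x hx => ?_).1 h2
    by_contra hx'
    exact hx (by simp [stepBump_eq_zero hab n hx'])
  rw [mulFun, h.integral_eq hint]
  congr 1 with x
  rw [Complex.real_smul, Complex.real_smul]
  ring

theorem tendsto_distribDeriv_stepBump {f : ℝ → ℂ} (hf : LocallyBoundedVariationOn f univ)
    (a b : ℝ) : Tendsto (fun n => distribDeriv f (stepBump a b n)) atTop
      (𝓝 (rightLim f b - rightLim f a)) := by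
  refine (tendsto_neg_integral_deriv_stepBump_smul hf.measurable_complex.stronglyMeasurable hf
    a b).congr fun n => ?_
  rw [distribDeriv]
  congr 2 with x
  rw [Complex.real_smul, mul_comm]

variable {J : Matrix (Fin 2) (Fin 2) ℝ} {q w : DistributionMatrix} {z : ℂ} {u : ℝ → Fin 2 → ℂ}

/-- The density of `J u'` with respect to `μ` for a solution `u`. -/
noncomputable def solutionDensity (q w : DistributionMatrix) (μ : Measure ℝ) (z : ℂ)
    (u : ℝ → Fin 2 → ℂ) (x : ℝ) (i : Fin 2) : ℂ :=
  ∑ j, (z * (w.density μ x i j : ℂ) - (q.density μ x i j : ℂ)) * u x j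

theorem integrableOn_solutionDensity (hu : LocallyBoundedVariationOn u univ)
    (hq : ∀ i j, (q i j).DominatedBy μ) (hw : ∀ i j, (w i j).DominatedBy μ) (i : Fin 2)
    (a b : ℝ) : IntegrableOn (fun x => solutionDensity q w μ z u x i) (Icc a b) μ := by
  unfold solutionDensity
  refine integrable_finsetSum _ fun j _ => ?_
  have h1 := ((hw i j).integrableOn_density_mul (hu.apply j) a b).const_mul z
  have h2 := (hq i j).integrableOn_density_mul (hu.apply j) a b
  refine (h1.sub h2).congr (Eventually.of_forall fun x => ?_)
  simp only [Pi.sub_apply, DistributionMatrix.density, Matrix.of_apply]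
  ring

theorem norm_solutionDensity_le (hq : ∀ i j, (q i j).DominatedBy μ)
    (hw : ∀ i j, (w i j).DominatedBy μ) :
    ∀ᵐ x ∂μ, ∀ i, ‖solutionDensity q w μ z u x i‖ ≤ 2 * (‖z‖ + 1) * ‖u x‖ := by
  have h1 : ∀ᵐ x ∂μ, ∀ i j, |(q i j).density μ x| ≤ 1 ∧ |(w i j).density μ x| ≤ 1 :=
    ae_all_iff.2 fun i => ae_all_iff.2 fun j =>
      (hq i j).ae_abs_density_le.and (hw i j).ae_abs_density_le
  filter_upwards [h1] with x hx i
  have h2 : ∀ j, ‖(z * (w.density μ x i j : ℂ) - (q.density μ x i j : ℂ)) * u x j‖ ≤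
      (‖z‖ + 1) * ‖u x‖ := by
    intro j
    rw [norm_mul]
    refine mul_le_mul ?_ (norm_le_pi_norm _ j) (norm_nonneg _) (by positivity)
    refine (norm_sub_le _ _).trans (add_le_add ?_ ?_)
    · rw [norm_mul, Complex.norm_real]
      exact mul_le_of_le_one_right (norm_nonneg _) (hx i j).2
    · rw [Complex.norm_real]
      exact (hx i j).1
  rw [solutionDensity, Fin.sum_univ_two]
  refine (norm_add_le _ _).trans ?_
  linarith [h2 0, h2 1]

/-- Test the equation against the bumps for `(a, b]` and pass to the limit in each term. -/
theorem IsSolution.integral_equation (hu : IsSolution J q w z u)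
    (hq : ∀ i j, (q i j).DominatedBy μ) (hw : ∀ i j, (w i j).DominatedBy μ) (i : Fin 2)
    {a b : ℝ} (hab : a ≤ b) :
    ∑ j, (J i j : ℂ) * (rightLim (fun x => u x j) b - rightLim (fun x => u x j) a) =
      ∫ x in Ioc a b, solutionDensity q w μ z u x i ∂μ := by
  obtain ⟨hbv, -, heq⟩ := hu
  have l1 := tendsto_finsetSum (Finset.univ : Finset (Fin 2)) fun j _ =>
    (tendsto_distribDeriv_stepBump (hbv.apply j) a b).const_mul (J i j : ℂ)
  have l2 := tendsto_finsetSum (Finset.univ : Finset (Fin 2)) fun j _ =>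
    (hq i j).tendsto_mulFun_stepBump (hbv.apply j) hab
  have l3 := (tendsto_finsetSum (Finset.univ : Finset (Fin 2)) fun j _ =>
    (hw i j).tendsto_mulFun_stepBump (hbv.apply j) hab).const_mul z
  have h1 := tendsto_nhds_unique ((l1.add l2).congr fun n => heq (stepBump a b n) i) l3
  have i1 : ∀ j, Integrable (fun x => ((w i j).density μ x : ℂ) * u x j) (μ.restrict (Ioc a b)) :=
    fun j => ((hw i j).integrableOn_density_mul (hbv.apply j) a b).mono_set Ioc_subset_Icc_self
  have i2 : ∀ j, Integrable (fun x => ((q i j).density μ x : ℂ) * u x j) (μ.restrict (Ioc a b)) :=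
    fun j => ((hq i j).integrableOn_density_mul (hbv.apply j) a b).mono_set Ioc_subset_Icc_self
  have h2 : ∫ x in Ioc a b, solutionDensity q w μ z u x i ∂μ =
      z * ∑ j, ∫ x in Ioc a b, ((w i j).density μ x : ℂ) * u x j ∂μ -
        ∑ j, ∫ x in Ioc a b, ((q i j).density μ x : ℂ) * u x j ∂μ := by
    rw [← integral_finsetSum _ fun j _ => i1 j, ← integral_finsetSum _ fun j _ => i2 j,
      ← integral_const_mul, ← integral_sub
        ((integrable_finsetSum _ fun j _ => i1 j).const_mul z)
        (integrable_finsetSum _ fun j _ => i2 j)]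
    congr 1 with x
    simp only [solutionDensity, DistributionMatrix.density, Matrix.of_apply, Fin.sum_univ_two]
    ring
  rw [h2, ← h1]
  ring

theorem rightLim_apply (hu : LocallyBoundedVariationOn u univ) (x : ℝ) (i : Fin 2) :
    rightLim (fun x => u x i) x = rightLim u x i :=
  rightLim_eq_of_tendsto (tendsto_pi_nhds.1 (hu.tendsto_rightLim x) i)

theorem leftLim_apply (hu : LocallyBoundedVariationOn u univ) (x : ℝ) (i : Fin 2) :
    leftLim (fun x => u x i) x = leftLim u x i :=
  leftLim_eq_of_tendsto (tendsto_pi_nhds.1 (hu.tendsto_leftLim x) i)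

/-- The density of `u'` with respect to `μ` for a solution `u`, where `c` is the upper right entry
of `J`. -/
noncomputable def derivDensity (c : ℝ) (q w : DistributionMatrix) (μ : Measure ℝ) (z : ℂ)
    (u : ℝ → Fin 2 → ℂ) (x : ℝ) : Fin 2 → ℂ :=
  ![-(c : ℂ)⁻¹ * solutionDensity q w μ z u x 1, (c : ℂ)⁻¹ * solutionDensity q w μ z u x 0]

theorem IsSolution.isBalancedPrimitive (hu : IsSolution J q w z u) (hJ : J.transpose = -J)
    (hc : J 0 1 ≠ 0) (hq : ∀ i j, (q i j).DominatedBy μ) (hw : ∀ i j, (w i j).DominatedBy μ)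
    (i : Fin 2) :
    IsBalancedPrimitive μ (fun x => derivDensity (J 0 1) q w μ z u x i) (fun x => u x i) := by
  have hc' : (J 0 1 : ℂ) ≠ 0 := by exact_mod_cast hc
  have hJ' : ∀ i j, J j i = -J i j := fun i j => congrFun (congrFun hJ i) j
  refine ⟨hu.1.apply i, fun x => ?_, fun a b => ?_, fun a b hab => ?_⟩
  · rw [rightLim_apply hu.1, leftLim_apply hu.1]
    exact congrFun (hu.2.1 x) i
  · fin_cases i
    · exact (integrableOn_solutionDensity hu.1 hq hw 1 a b).const_mul _
    · exact (integrableOn_solutionDensity hu.1 hq hw 0 a b).const_mul _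
  · have h0 := hu.integral_equation hq hw 0 hab
    have h1 := hu.integral_equation hq hw 1 hab
    have j0 : J 0 0 = 0 := by linarith [hJ' 0 0]
    have j1 : J 1 1 = 0 := by linarith [hJ' 1 1]
    rw [Fin.sum_univ_two, j0] at h0
    rw [Fin.sum_univ_two, j1, hJ' 0 1] at h1
    push_cast at h0 h1
    fin_cases i
    · simp only [derivDensity, Fin.zero_eta, Matrix.cons_val_zero]
      rw [integral_const_mul, ← h1]
      field_simp
      ring
    · simp only [derivDensity, Fin.mk_one, Matrix.cons_val_one, Matrix.cons_val_zero]
      rw [integral_const_mul, ← h0]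
      field_simp
      ring

end IntegralEquation

/-! ### Jump matrices at a single point. -/

variable {J : Matrix (Fin 2) (Fin 2) ℝ} {q w : DistributionMatrix} {z : ℂ} {u : ℝ → Fin 2 → ℂ}
  {μ : Measure ℝ} [IsLocallyFiniteMeasure μ]

theorem ae_of_measureReal_singleton_ne_zero {μ : Measure ℝ} {P : ℝ → Prop}
    (h : ∀ᵐ x ∂μ, P x) {x : ℝ} (hx : μ.real {x} ≠ 0) : P x := by
  by_contra hP
  have h0 : μ {x} = 0 := measure_mono_null (by simpa using hP) (ae_iff.1 h)
  exact hx (by simp [measureReal_def, h0])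

/-- The jump is the mass of the atom times the density there, and an almost everywhere property
holds at every atom. -/
theorem DistributionMatrix.IsNonneg.posSemidef_jump {r : DistributionMatrix} (h : r.IsNonneg)
    (hμ : ∀ i j, (r i j).DominatedBy μ) (x : ℝ) :
    (Matrix.of fun i j => (r i j).jump x : Matrix (Fin 2) (Fin 2) ℝ).PosSemidef := by
  have e : (Matrix.of fun i j => (r i j).jump x : Matrix (Fin 2) (Fin 2) ℝ) =
      μ.real {x} • r.density μ x := by
    ext i j
    simp [← (hμ i j).measureReal_mul_density x, density]
  rw [e]
  by_cases h0 : μ.real {x} = 0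
  · rw [h0, zero_smul]
    exact Matrix.PosSemidef.zero
  · exact (ae_of_measureReal_singleton_ne_zero (h.ae_posSemidef_density hμ) h0).smul
      measureReal_nonneg

theorem Matrix.apply_of_transpose_eq_neg (hJ : J.transpose = -J) :
    J 0 0 = 0 ∧ J 1 1 = 0 ∧ J 1 0 = -J 0 1 := by
  have hJ' : ∀ i j, J j i = -J i j := fun i j => congrFun (congrFun hJ i) j
  exact ⟨by linarith [hJ' 0 0], by linarith [hJ' 1 1], hJ' 0 1⟩

theorem det_BPlus (hJ : J.transpose = -J) (x : ℝ) :
    (BPlus J q w x z).det =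
      1 / 2 * (((q 0 0).jump x : ℂ) - z * (w 0 0).jump x) *
          (1 / 2 * (((q 1 1).jump x : ℂ) - z * (w 1 1).jump x)) -
        (1 / 2 * (((q 0 1).jump x : ℂ) - z * (w 0 1).jump x) + J 0 1) *
          (1 / 2 * (((q 1 0).jump x : ℂ) - z * (w 1 0).jump x) - J 0 1) := by
  obtain ⟨h0, h1, h2⟩ := Matrix.apply_of_transpose_eq_neg hJ
  rw [Matrix.det_fin_two]
  simp [BPlus, DistributionMatrix.jump, h0, h1, h2]
  ring

/-- Parameter `0` suffices: once `Δ_w(x) p = 0`, the vector `B₊(x, z) p` does not depend on `z`. -/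
theorem eq_zero_of_BPlus_mulVec (hJ : J.transpose = -J) {x : ℝ}
    (hB : IsUnit (BPlus J q w x ((0 : ℝ) : ℂ))) {p : Fin 2 → ℂ}
    (h0 : J 0 1 * p 1 + 1 / 2 * ∑ j, ((q 0 j).jump x : ℂ) * p j = 0)
    (h1 : -J 0 1 * p 0 + 1 / 2 * ∑ j, ((q 1 j).jump x : ℂ) * p j = 0) (i : Fin 2) : p i = 0 := by
  obtain ⟨j0, j1, j2⟩ := Matrix.apply_of_transpose_eq_neg hJ
  have hdet : (BPlus J q w x ((0 : ℝ) : ℂ)).det ≠ 0 :=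
    ((Matrix.isUnit_iff_isUnit_det _).1 hB).ne_zero
  refine congrFun (Matrix.eq_zero_of_mulVec_eq_zero hdet (funext fun i => ?_)) i
  rw [Fin.sum_univ_two] at h0 h1
  fin_cases i
  · simp [Matrix.mulVec, dotProduct, BPlus, DistributionMatrix.jump, j0]
    linear_combination h0
  · simp [Matrix.mulVec, dotProduct, BPlus, DistributionMatrix.jump, j1, j2]
    linear_combination h1

/-! ### Solutions at and between singular points. -/

namespace IsSolution

theorem derivDensity_spec {μ : Measure ℝ} {c : ℝ} (hc : c ≠ 0) (x : ℝ) :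
    c * derivDensity c q w μ z u x 1 = solutionDensity q w μ z u x 0 ∧
      -c * derivDensity c q w μ z u x 0 = solutionDensity q w μ z u x 1 := by
  have hc' : (c : ℂ) ≠ 0 := by exact_mod_cast hc
  simp [derivDensity, hc']

theorem measureReal_mul_solutionDensity (hq : ∀ i j, (q i j).DominatedBy μ)
    (hw : ∀ i j, (w i j).DominatedBy μ) (x : ℝ) (i : Fin 2) :
    (μ.real {x} : ℂ) * solutionDensity q w μ z u x i =
      ∑ j, (z * ((w i j).jump x : ℂ) - (q i j).jump x) * u x j := by
  simp only [solutionDensity, DistributionMatrix.density, Matrix.of_apply, Finset.mul_sum,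
    ← (hq _ _).measureReal_mul_density x, ← (hw _ _).measureReal_mul_density x]
  refine Finset.sum_congr rfl fun j _ => ?_
  push_cast
  ring

/-- Since `u` is balanced, this is the relation `B₊ u⁺ = B₋ u⁻`. -/
theorem jump_equation (hu : IsSolution J q w z u) (hJ : J.transpose = -J)
    (hc : J 0 1 ≠ 0) (hq : ∀ i j, (q i j).DominatedBy μ) (hw : ∀ i j, (w i j).DominatedBy μ)
    (x : ℝ) :
    J 0 1 * (rightLim u x 1 - leftLim u x 1) =
        ∑ j, (z * ((w 0 j).jump x : ℂ) - (q 0 j).jump x) * u x j ∧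
      -J 0 1 * (rightLim u x 0 - leftLim u x 0) =
        ∑ j, (z * ((w 1 j).jump x : ℂ) - (q 1 j).jump x) * u x j := by
  have h := fun i => (hu.isBalancedPrimitive hJ hc hq hw i).rightLim_sub_leftLim x
  simp only [rightLim_apply hu.1, leftLim_apply hu.1] at h
  rw [h 0, h 1, ← measureReal_mul_solutionDensity hq hw x 0,
    ← measureReal_mul_solutionDensity hq hw x 1, ← (derivDensity_spec hc x).1,
    ← (derivDensity_spec hc x).2]
  constructor <;> ring

theorem apply_eq_half_add (hu : IsSolution J q w z u) (x : ℝ) (i : Fin 2) :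
    u x i = 1 / 2 * (rightLim u x i + leftLim u x i) := congrFun (hu.2.1 x) i

theorem kernel_of_det_eq_zero (hu : IsSolution J q w z u) (hJ : J.transpose = -J)
    (hc : J 0 1 ≠ 0) (hq : ∀ i j, (q i j).DominatedBy μ) (hw : ∀ i j, (w i j).DominatedBy μ)
    (hq_symm : q.IsSymm) (hw_nonneg : w.IsNonneg) {x : ℝ} (hx : (BPlus J q w x z).det = 0) :
    (J 0 1 * rightLim u x 1 +
          1 / 2 * ∑ j, (((q 0 j).jump x : ℂ) - z * (w 0 j).jump x) * rightLim u x j = 0 ∧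
        -J 0 1 * rightLim u x 0 +
          1 / 2 * ∑ j, (((q 1 j).jump x : ℂ) - z * (w 1 j).jump x) * rightLim u x j = 0) ∧
      (-J 0 1 * leftLim u x 1 +
          1 / 2 * ∑ j, (((q 0 j).jump x : ℂ) - z * (w 0 j).jump x) * leftLim u x j = 0 ∧
        J 0 1 * leftLim u x 0 +
          1 / 2 * ∑ j, (((q 1 j).jump x : ℂ) - z * (w 1 j).jump x) * leftLim u x j = 0) := by
  obtain ⟨h0, h1⟩ := hu.jump_equation hJ hc hq hw x
  have hqs : q 1 0 = q 0 1 := hq_symm.apply 0 1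
  have hws : (w 1 0).jump x = (w 0 1).jump x := by
    simpa using (hw_nonneg.posSemidef_jump hw x).isHermitian.apply 0 1
  rw [det_BPlus hJ, hqs, hws] at hx
  simp only [Fin.sum_univ_two, hqs, hws, hu.apply_eq_half_add x] at h0 h1 ⊢
  obtain ⟨⟨e0, e1⟩, e2, e3⟩ := jump_eq_zero_of_det_eq_zero (p₀ := rightLim u x 0)
    (p₁ := rightLim u x 1) (m₀ := leftLim u x 0) (m₁ := leftLim u x 1)
    (c := J 0 1) (by exact_mod_cast hc) hx
    (by linear_combination h0) (by linear_combination h1)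
  refine ⟨⟨?_, ?_⟩, ?_, ?_⟩
  · linear_combination e0
  · linear_combination e1
  · linear_combination e2
  · linear_combination e3

/-- A solution vanishes between two points at which `B₊` and `B₋` are singular. -/
theorem eq_zero_of_mem_Ico (hu : IsSolution J q w z u) (hJ : J.transpose = -J)
    (hc : J 0 1 ≠ 0) (hq : ∀ i j, (q i j).DominatedBy μ) (hw : ∀ i j, (w i j).DominatedBy μ)
    (hq_symm : q.IsSymm) (hw_nonneg : w.IsNonneg) (hz : z.im ≠ 0)
    (hB : ∀ x, IsUnit (BPlus J q w x ((0 : ℝ) : ℂ))) {a b : ℝ} (hab : a < b)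
    (ha : (BPlus J q w a z).det = 0) (hb : (BPlus J q w b z).det = 0) {x : ℝ} (hx : x ∈ Ico a b) :
    rightLim u x = 0 := by
  set c := J 0 1
  have hprim := hu.isBalancedPrimitive hJ hc hq hw
  have hqs : ∀ x, (q 1 0).jump x = (q 0 1).jump x := fun x => by
    rw [show q 1 0 = q 0 1 from hq_symm.apply 0 1]
  have hwpsd := fun x => hw_nonneg.posSemidef_jump hw x
  have hws : ∀ x, (w 1 0).jump x = (w 0 1).jump x := fun x => by
    simpa using (hwpsd x).isHermitian.apply 0 1
  obtain ⟨⟨pa0, pa1⟩, -⟩ := hu.kernel_of_det_eq_zero hJ hc hq hw hq_symm hw_nonneg ha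
  obtain ⟨-, pb0, pb1⟩ := hu.kernel_of_det_eq_zero hJ hc hq hw hq_symm hw_nonneg hb
  have energy_a := energy_of_kernel (v := rightLim u a)
    (D := Matrix.of fun i j => (w i j).jump a) (E := Matrix.of fun i j => (q i j).jump a)
    (hws a) (hqs a) c z pa0 pa1
  -- The kernel of `B₋` is that of `-J + S`, where `S` is the symmetric part of `B₊`, so `c` changes
  -- sign. This makes the term at `b` add to the one at `a`.
  have energy_b := energy_of_kernel (v := leftLim u b)
    (D := Matrix.of fun i j => (w i j).jump b) (E := Matrix.of fun i j => (q i j).jump b)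
    (hws b) (hqs b) (-c) z (by push_cast; exact pb0) (by push_cast; rw [neg_neg]; exact pb1)
  obtain ⟨hint, hparts⟩ := (hprim 0).conj.integrableOn_and_mul_sub_mul (hprim 1) hab
  have hconjr : rightLim (fun x => starRingEnd ℂ (u x 0)) a = starRingEnd ℂ (rightLim u a 0) :=
    rightLim_eq_of_tendsto ((Complex.continuous_conj.tendsto _).comp
      (tendsto_pi_nhds.1 (hu.1.tendsto_rightLim a) 0))
  have hconjl : leftLim (fun x => starRingEnd ℂ (u x 0)) b = starRingEnd ℂ (leftLim u b 0) :=
    leftLim_eq_of_tendsto ((Complex.continuous_conj.tendsto _).comp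
      (tendsto_pi_nhds.1 (hu.1.tendsto_leftLim b) 0))
  rw [rightLim_apply hu.1, leftLim_apply hu.1, hconjr, hconjl] at hparts
  have hWae : ∀ᵐ x ∂(μ.restrict (Ioo a b)), (w.density μ x).PosSemidef :=
    ae_restrict_of_ae (hw_nonneg.ae_posSemidef_density hw)
  have hdens : (fun x => c * (starRingEnd ℂ (derivDensity c q w μ z u x 0) * u x 1 +
      starRingEnd ℂ (u x 0) * derivDensity c q w μ z u x 1).im) =ᵐ[μ.restrict (Ioo a b)]
      fun x => z.im * complexQuadForm (w.density μ x) (u x) := by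
    filter_upwards [hWae] with x hx
    refine energy_density (Q := q.density μ x) ?_ ?_ z ?_ ?_
    · simp only [DistributionMatrix.density, Matrix.of_apply]
      rw [show q 1 0 = q 0 1 from hq_symm.apply 0 1]
    · simpa using hx.isHermitian.apply 0 1
    · exact (derivDensity_spec hc x).1
    · exact (derivDensity_spec hc x).2
  have hint_im := (hint.im.const_mul c).congr hdens
  have hint_form : IntegrableOn (fun x => complexQuadForm (w.density μ x) (u x)) (Ioo a b) μ := by
    refine (hint_im.const_mul z.im⁻¹).congr (Eventually.of_forall fun x => ?_)
    simp only [inv_mul_cancel_left₀ hz]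
  have henergy : c * (starRingEnd ℂ (leftLim u b 0) * leftLim u b 1 -
      starRingEnd ℂ (rightLim u a 0) * rightLim u a 1).im =
      z.im * ∫ x in Ioo a b, complexQuadForm (w.density μ x) (u x) ∂μ := by
    rw [hparts, ← integral_const_mul, ← integral_congr_ae hdens, integral_const_mul]
    congr 1
    exact (integral_im hint).symm
  have hform_nonneg : ∀ᵐ x ∂(μ.restrict (Ioo a b)),
      0 ≤ complexQuadForm (w.density μ x) (u x) := by
    filter_upwards [hWae] with x hx
    exact complexQuadForm_nonneg hx _
  have hI := integral_nonneg_of_ae hform_nonneg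
  have hDa := complexQuadForm_nonneg (hwpsd a) (rightLim u a)
  have hDb := complexQuadForm_nonneg (hwpsd b) (leftLim u b)
  -- The energy balance after division by `Im z ≠ 0`; all three terms are non-negative.
  have hsum : (∫ x in Ioo a b, complexQuadForm (w.density μ x) (u x) ∂μ) +
      1 / 4 * complexQuadForm (Matrix.of fun i j => (w i j).jump a) (rightLim u a) +
      1 / 4 * complexQuadForm (Matrix.of fun i j => (w i j).jump b) (leftLim u b) = 0 := by
    apply mul_left_cancel₀ hz
    rw [Complex.sub_im] at henergy
    linear_combination -henergy - energy_a - energy_b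
  have hDa0 := sum_mul_eq_zero_of_complexQuadForm (hwpsd a) (v := rightLim u a) (by linarith)
  have hI0 : ∫ x in Ioo a b, complexQuadForm (w.density μ x) (u x) ∂μ = 0 := by linarith
  have hua : ∀ i, rightLim u a i = 0 := by
    have e0 := hDa0 0
    have e1 := hDa0 1
    simp only [Matrix.of_apply, Fin.sum_univ_two] at e0 e1 pa0 pa1
    refine eq_zero_of_BPlus_mulVec hJ (hB a) ?_ ?_
    · rw [Fin.sum_univ_two]
      linear_combination pa0 + z / 2 * e0
    · rw [Fin.sum_univ_two]
      linear_combination pa1 + z / 2 * e1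
  have hWu : ∀ᵐ x ∂μ, x ∈ Ioo a b → ∀ i, ∑ j, (w.density μ x i j : ℂ) * u x j = 0 := by
    rw [← ae_restrict_iff' measurableSet_Ioo]
    filter_upwards [hWae, (integral_eq_zero_iff_of_nonneg_ae hform_nonneg hint_form).1 hI0]
      with x h1 h2
    exact sum_mul_eq_zero_of_complexQuadForm h1 h2
  -- If `u⁻ = 0`, then `u = u⁺ / 2`. Since `Δ_w u = 0`, the jump equation loses its `z` term and
  -- becomes `B₊(x, 0) u⁺ = 0`.
  have hjump : ∀ x ∈ Ioo a b, (∀ i, leftLim (fun x => u x i) x = 0) →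
      ∀ i, rightLim (fun x => u x i) x = 0 := by
    intro x hx hl
    simp only [rightLim_apply hu.1, leftLim_apply hu.1] at hl ⊢
    have hwu : ∀ i, ∑ j, ((w i j).jump x : ℂ) * u x j = 0 := by
      intro i
      have e : ∑ j, ((w i j).jump x : ℂ) * u x j =
          μ.real {x} * ∑ j, (w.density μ x i j : ℂ) * u x j := by
        simp only [Finset.mul_sum, ← (hw _ _).measureReal_mul_density x,
          DistributionMatrix.density, Matrix.of_apply, Complex.ofReal_mul, mul_assoc]
      rw [e]
      by_cases h0 : μ.real {x} = 0
      · rw [h0, Complex.ofReal_zero, zero_mul]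
      · rw [ae_of_measureReal_singleton_ne_zero hWu h0 hx i, mul_zero]
    obtain ⟨h0, h1⟩ := hu.jump_equation hJ hc hq hw x
    have e0 := hwu 0
    have e1 := hwu 1
    simp only [Fin.sum_univ_two, hu.apply_eq_half_add x, hl] at h0 h1 e0 e1
    refine eq_zero_of_BPlus_mulVec hJ (hB x) ?_ ?_
    · rw [Fin.sum_univ_two]
      linear_combination h0 + z * e0
    · rw [Fin.sum_univ_two]
      linear_combination h1 + z * e1
  have hbound : ∀ᵐ x ∂μ, ∀ i, ‖derivDensity c q w μ z u x i‖ ≤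
      |c|⁻¹ * (2 * (‖z‖ + 1)) * ‖u x‖ := by
    filter_upwards [norm_solutionDensity_le (z := z) (u := u) hq hw] with x hx i
    rw [mul_assoc]
    fin_cases i
    · simpa [derivDensity] using
        mul_le_mul_of_nonneg_left (hx 1) (inv_nonneg.2 (abs_nonneg c))
    · simpa [derivDensity] using
        mul_le_mul_of_nonneg_left (hx 0) (inv_nonneg.2 (abs_nonneg c))
  have hK : 0 < |c|⁻¹ * (2 * (‖z‖ + 1)) := by
    have := abs_pos.2 hc
    positivity
  ext i
  rw [← rightLim_apply hu.1]
  exact rightLim_eq_zero_of_jump hprim hK hbound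
    (fun i => by rw [rightLim_apply hu.1, hua]) hjump hx i

end IsSolution

/-! ### Periodicity and conclusion. -/

theorem periodic_det_BPlus {ω : ℝ} (hq : q.HasPeriod ω) (hw : w.HasPeriod ω) :
    Periodic (fun x => (BPlus J q w x z).det) ω := by
  intro x
  have hq' : q.jump (x + ω) = q.jump x := by
    ext i j
    simp [DistributionMatrix.jump, (hq i j).periodic_jump x]
  have hw' : w.jump (x + ω) = w.jump x := by
    ext i j
    simp [DistributionMatrix.jump, (hw i j).periodic_jump x]
  simp only [BPlus, hq', hw']

theorem theorem6p4
    (J : Matrix (Fin 2) (Fin 2) ℝ) (hJ_skew : J.transpose = -J) (hJ_inv : IsUnit J)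
    (q w : DistributionMatrix) (hq_symm : q.IsSymm) (hw_nonneg : w.IsNonneg)
    (ω : ℝ) (hω : 0 < ω) (hq_per : q.HasPeriod ω) (hw_per : w.HasPeriod ω)
    (hB : ∀ t x : ℝ, IsUnit (BPlus J q w x (t : ℂ)) ∧ IsUnit (BMinus J q w x (t : ℂ)))
    (z : ℂ) (hz : z ∈ singularSet J q w)
    (u : ℝ → Fin 2 → ℂ) (hu : IsSolution J q w z u) :
    ∀ x, u x = 0 := by
  obtain ⟨x₀, hx₀, -⟩ := hz
  have hc : J 0 1 ≠ 0 := by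
    intro h0
    obtain ⟨j0, j1, j2⟩ := Matrix.apply_of_transpose_eq_neg hJ_skew
    have := ((Matrix.isUnit_iff_isUnit_det _).1 hJ_inv).ne_zero
    exact this (by simp [Matrix.det_fin_two, j0, j2, h0])
  have hz : z.im ≠ 0 := by
    intro h0
    have hre : ((z.re : ℝ) : ℂ) = z := Complex.ext (by simp) (by simp [h0])
    have := (hB z.re x₀).1
    rw [hre] at this
    exact ((Matrix.isUnit_iff_isUnit_det _).1 this).ne_zero hx₀
  have : IsLocallyFiniteMeasure (q.totalMeasure + w.totalMeasure) := by
    have : IsFiniteMeasureOnCompacts (q.totalMeasure + w.totalMeasure) :=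
      ⟨fun K hK => by simp [hK.measure_lt_top]⟩
    infer_instance
  have hq : ∀ i j, (q i j).DominatedBy (q.totalMeasure + w.totalMeasure) := fun i j =>
    (q.dominatedBy_totalMeasure i j).mono (Measure.le_add_right le_rfl)
  have hw : ∀ i j, (w i j).DominatedBy (q.totalMeasure + w.totalMeasure) := fun i j =>
    (w.dominatedBy_totalMeasure i j).mono (Measure.le_add_left le_rfl)
  have hright : rightLim u = 0 := by
    ext1 x
    -- Translates of `[x₀, x₀ + ω)` tile the line, and the endpoints of each are singular points.
    obtain ⟨n, hn, -⟩ := existsUnique_sub_zsmul_mem_Ico hω x x₀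
    have hper : Periodic (fun x => (BPlus J q w x z).det) ω := periodic_det_BPlus hq_per hw_per
    have h1 : (BPlus J q w (x₀ + n * ω) z).det = 0 := (hper.int_mul n x₀).trans hx₀
    have h2 : (BPlus J q w (x₀ + n * ω + ω) z).det = 0 := (hper _).trans h1
    refine hu.eq_zero_of_mem_Ico hJ_skew hc hq hw hq_symm hw_nonneg hz (fun x => (hB 0 x).1)
      (lt_add_of_pos_right _ hω) h1 h2 ?_
    rw [zsmul_eq_mul] at hn
    constructor <;> linarith [hn.1, hn.2]
  intro x
  -- Left limits of `u` are left limits of `u⁺`, which is identically zero.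
  have hleft : leftLim u x = 0 := by
    refine tendsto_nhds_unique (hu.1.tendsto_rightLim_leftLim x) ?_
    rw [hright]
    exact tendsto_const_nhds
  rw [hu.2.1 x, hright, hleft]
  simp
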